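/- Let $F \subseteq F'$ be totally real number fields with rings of integers $\mathfrak{r} \subseteq \mathfrak{r}'$, let $\theta_{F'/F} \subseteq \mathfrak{r}'$ be the relative different, let $K$ be a totally imaginary quadratic extension of $F$ with ring of integers $\mathfrak{R}$, and let $K' = KF'$ with ring of integers $\mathfrak{R}'$. Let $k$ be a field with a fixed embedding into $\mathbb{C}$. A Hilbert-Blumenthal abelian variety (HBAV) over $k$ with real multiplication by $\mathfrak{r}$ is an abelian variety $X$ over $k$ of dimension $[F:\mathbb{Q}]$ with an embedding $\mathfrak{r} \hookrightarrow \mathrm{End}(X)$; it has CM by $\mathfrak{R}$ if it is equipped with an embedding $\mathfrak{R} \hookrightarrow \mathrm{End}(X)$ that extends the real multiplication. For a CM type $\Sigma$ of $K$ and a fractional ideal $\mathfrak{U} \neq 0$ of $K$, such an $X$ is said to be of type $(K,\Sigma)$ and to correspond to $\mathfrak{U}$, written $X = X(\mathfrak{U})$, if there is an $\mathfrak{R}$-equivariant isomorphism of complex Lie groups $X(\mathbb{C}) \cong \mathbb{C}^{\Sigma}/\Sigma(\mathfrak{U})$, where $\Sigma(\mathfrak{U}) = \{(\sigma(x))_{\sigma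 \in \Sigma} : x \in \mathfrak{U}\}$. The same definitions apply to $F'$, $K'$, $\mathfrak{r}'$, $\mathfrak{R}'$. For an HBAV $X$ over $k$ with real multiplication by $\mathfrak{r}$, let $X \otimes_{\mathfrak{r}} \theta_{F'/F}^{-1}$ denote the HBAV over $k$ with real multiplication by $\mathfrak{r}'$ that represents the functor $S \mapsto X(S) \otimes_{\mathfrak{r}} \theta_{F'/F}^{-1}$ from $k$-schemes to $\mathfrak{r}'$-modules. Assume that $\mathfrak{R}' = \mathfrak{R}\mathfrak{r}'$. Let $\Sigma$ be a CM type of $K$, let $\Sigma'$ be its lift to $K'$ (all embeddings $K' \to \mathbb{C}$ whose restriction to $K$ lies in $\Sigma$), let $\mathfrak{U} \neq 0$ be a fractional ideal of $K$, and let $X(\mathfrak{U})$ be an HBAV over $k$ with CM by $\mathfrak{R}$ of type $(K,\Sigma)$ that corresponds to $\mathfrak{U}$. Then the HBAV $X(\mathfrak{U}) \otimes_{\mathfrak{r}} \theta_{F'/F}^{-1}$ has CM by $\mathfrak{R}'$, where the action of $\mathfrak{R} \subseteq \mathfrak{R}'$ is the one induced by its action on $X(\mathfrak{U})$, and with this CM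 it is of type $(K',\Sigma')$ and corresponds to the fractional ideal $\mathfrak{U}\mathfrak{D}^{-1} = \mathfrak{U}\mathfrak{R}' \cdot \mathfrak{D}^{-1}$ of $K'$, where $\mathfrak{D} = \theta_{F'/F}\mathfrak{R}'$. -/

import Mathlib

open CategoryTheory AlgebraicGeometry NumberField
open scoped TensorProduct nonZeroDivisors

noncomputable section

/-! ### Ring actions on commutative group objects -/

section RingAction

open MonObj

variable {C : Type*} [Category C] [CartesianMonoidalCategory C] [BraidedCategory C]

/-- An action of a commutative ring `O` on a commutative group object `G`: a ring homomorphism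
`O → End(G)`. The sum of two endomorphisms is formed with the group law of `G`, which Mathlib
writes multiplicatively on `Hom(T, G)`. -/
structure GrpRingAction (O : Type*) [CommRing O] (G : C) [GrpObj G] [IsCommMonObj G] where
  /-- the endomorphism given by `a` -/
  act : O → (G ⟶ G)
  isMonHom : ∀ a, IsMonHom (act a)
  act_one : act 1 = 𝟙 G
  act_mul : ∀ a b, act (a * b) = act b ≫ act a
  act_add : ∀ a b, act (a + b) = act a * act b

/-- The `T`-valued points `G(T) = Hom(T, G)` of a commutative group object, written additively. -/
def GrpPoints (G T : C) : Type _ := Additive (T ⟶ G)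

instance GrpPoints.instAddCommGroup (G T : C) [GrpObj G] [IsCommMonObj G] :
    AddCommGroup (GrpPoints G T) :=
  inferInstanceAs (AddCommGroup (Additive (T ⟶ G)))

/-- The point given by a morphism. -/
def GrpPoints.mk {G T : C} (x : T ⟶ G) : GrpPoints G T := Additive.ofMul x

/-- The morphism underlying a point. -/
def GrpPoints.hom {G T : C} (x : GrpPoints G T) : T ⟶ G := Additive.toMul x

/-- The pullback of points `G(T) → G(S)` along `f : S ⟶ T`. -/
def GrpPoints.pull (G : C) [GrpObj G] [IsCommMonObj G] {S T : C} (f : S ⟶ T) :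
    GrpPoints G T →+ GrpPoints G S where
  toFun x := .mk (f ≫ x.hom)
  map_zero' := by
    change f ≫ (1 : T ⟶ G) = (1 : S ⟶ G)
    exact MonObj.comp_one f
  map_add' x y := by
    change f ≫ (x.hom * y.hom) = (f ≫ x.hom) * (f ≫ y.hom)
    exact MonObj.comp_mul f _ _

/-- The endomorphism of the group `G(T)` given by a ring element, for an action on `G`. -/
def GrpRingAction.onPoints {O : Type*} [CommRing O] {G : C} [GrpObj G] [IsCommMonObj G]
    (ρ : GrpRingAction O G) (T : C) (a : O) : GrpPoints G T →+ GrpPoints G T where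
  toFun x := .mk (x.hom ≫ ρ.act a)
  map_zero' := by
    have := ρ.isMonHom a
    change (1 : T ⟶ G) ≫ ρ.act a = (1 : T ⟶ G)
    exact MonObj.one_comp _
  map_add' x y := by
    have := ρ.isMonHom a
    change (x.hom * y.hom) ≫ ρ.act a = (x.hom ≫ ρ.act a) * (y.hom ≫ ρ.act a)
    exact MonObj.mul_comp _ _ _

/-- The ring homomorphism from `O` to the endomorphisms of the group `G(T)`. -/
def GrpRingAction.toEnd {O : Type*} [CommRing O] {G : C} [GrpObj G] [IsCommMonObj G]
    (ρ : GrpRingAction O G) (T : C) : O →+* AddMonoid.End (GrpPoints G T) :=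
  RingHom.mk'
    { toFun := ρ.onPoints T
      map_one' := by
        refine AddMonoidHom.ext fun x => ?_
        change x.hom ≫ ρ.act 1 = x.hom
        rw [ρ.act_one, Category.comp_id]
      map_mul' := fun a b => by
        refine AddMonoidHom.ext fun x => ?_
        change x.hom ≫ ρ.act (a * b) = (x.hom ≫ ρ.act b) ≫ ρ.act a
        rw [ρ.act_mul, Category.assoc] }
    (fun a b => by
      refine AddMonoidHom.ext fun x => ?_
      change x.hom ≫ ρ.act (a + b) = (x.hom ≫ ρ.act a) * (x.hom ≫ ρ.act b)
      rw [ρ.act_add, MonObj.comp_mul])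

end RingAction

/-! ### Hilbert-Blumenthal abelian varieties -/

/-- A Hilbert-Blumenthal abelian variety over a field `k` of characteristic zero with real
multiplication by the ring of integers of the totally real field `F`: an abelian variety over `k`
of dimension `[F : ℚ]` with an embedding of `𝓞 F` into its ring of endomorphisms. (Over a field of
characteristic zero its Lie algebra is then automatically free of rank one over `𝓞 F ⊗ k`.) -/
structure HBAV (k : Type) [Field k] [CharZero k] (F : Type*) [Field F] [NumberField F] where
  /-- the underlying scheme over `k` -/
  X : Over (Spec (CommRingCat.of k))
  [grpObj : GrpObj X]
  [isCommMonObj : IsCommMonObj X]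
  [isProper : IsProper X.hom]
  [smooth : SmoothOfRelativeDimension (Module.finrank ℚ F) X.hom]
  [geometricallyIntegral : GeometricallyIntegral X.hom]
  /-- the real multiplication -/
  rm : GrpRingAction (𝓞 F) X
  rm_injective : Function.Injective rm.act

namespace HBAV

attribute [instance] HBAV.grpObj HBAV.isCommMonObj

variable {k : Type} [Field k] [CharZero k] {F : Type*} [Field F] [NumberField F]

/-- The group `X(T)` of `T`-valued points, for a scheme `T` over `k`. -/
abbrev Points (A : HBAV k F) (T : Over (Spec (CommRingCat.of k))) : Type := GrpPoints A.X T

/-- `X(T)` is an `𝓞 F`-module through the real multiplication. -/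
instance instModulePoints (A : HBAV k F) (T : Over (Spec (CommRingCat.of k))) :
    Module (𝓞 F) (A.Points T) :=
  Module.compHom (A.Points T) (A.rm.toEnd T)

/-- The `𝓞 F`-linear pullback `X(T) → X(S)` along a morphism `f : S ⟶ T` over `k`. -/
def pull (A : HBAV k F) {S T : Over (Spec (CommRingCat.of k))} (f : S ⟶ T) :
    A.Points T →ₗ[𝓞 F] A.Points S where
  toFun := GrpPoints.pull A.X f
  map_add' := map_add _
  map_smul' a x := by
    change f ≫ (x.hom ≫ A.rm.act a) = (f ≫ x.hom) ≫ A.rm.act a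
    rw [Category.assoc]

/-- Complex multiplication by the ring of integers of `K` on a Hilbert-Blumenthal abelian variety
with real multiplication by `𝓞 F`, where `K` is a totally imaginary quadratic extension of `F`:
an embedding `𝓞 K → End(X)` that extends the real multiplication. -/
structure CM (A : HBAV k F) (K : Type*) [Field K] [NumberField K] [Algebra F K] where
  /-- the complex multiplication -/
  cm : GrpRingAction (𝓞 K) A.X
  cm_injective : Function.Injective cm.act
  cm_algebraMap : ∀ a : 𝓞 F, cm.act (algebraMap (𝓞 F) (𝓞 K) a) = A.rm.act a

/-- The `𝓞 F`-linear endomorphism of `X(T)` given by an element of `𝓞 K`. -/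
def CM.onPoints {A : HBAV k F} {K : Type*} [Field K] [NumberField K] [Algebra F K]
    (c : A.CM K) (T : Over (Spec (CommRingCat.of k))) (a : 𝓞 K) :
    A.Points T →ₗ[𝓞 F] A.Points T where
  toFun := c.cm.onPoints T a
  map_add' := map_add _
  map_smul' b x := by
    change (x.hom ≫ A.rm.act b) ≫ c.cm.act a = (x.hom ≫ c.cm.act a) ≫ A.rm.act b
    rw [← c.cm_algebraMap, Category.assoc, Category.assoc, ← c.cm.act_mul, ← c.cm.act_mul,
      mul_comm]

end HBAV

/-! ### The tensor product of a Hilbert-Blumenthal abelian variety with the inverse different -/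

/-- The inverse `θ_{F'/F}⁻¹` of the relative different, a fractional ideal of `F'`. -/
def inverseDifferent (F F' : Type*) [Field F] [NumberField F] [Field F'] [NumberField F']
    [Algebra F F'] : FractionalIdeal (𝓞 F')⁰ F' :=
  (differentIdeal (𝓞 F) (𝓞 F') : FractionalIdeal (𝓞 F')⁰ F')⁻¹

/-- The `𝓞 F'`-module underlying `θ_{F'/F}⁻¹`. -/
abbrev InverseDifferent (F F' : Type*) [Field F] [NumberField F] [Field F'] [NumberField F']
    [Algebra F F'] : Type _ :=
  ↥((inverseDifferent F F' : FractionalIdeal (𝓞 F')⁰ F') : Submodule (𝓞 F') F')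

/-- `A'` is the Hilbert-Blumenthal abelian variety `A ⊗ θ_{F'/F}⁻¹`: it represents the functor
`T ↦ A(T) ⊗ θ_{F'/F}⁻¹` (tensor product over `𝓞 F`) from schemes over `k` to `𝓞 F'`-modules. The
factor `θ_{F'/F}⁻¹`, through which `𝓞 F'` acts, is written on the left. -/
structure HBAV.DifferentTwist {k : Type} [Field k] [CharZero k]
    {F F' : Type*} [Field F] [NumberField F] [Field F'] [NumberField F'] [Algebra F F']
    (A : HBAV k F) (A' : HBAV k F') where
  /-- the identification of the `T`-valued points -/
  equiv : ∀ T : Over (Spec (CommRingCat.of k)),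
    A'.Points T ≃ₗ[𝓞 F'] (InverseDifferent F F') ⊗[𝓞 F] (A.Points T)
  natural : ∀ {S T : Over (Spec (CommRingCat.of k))} (f : S ⟶ T) (x : A'.Points T),
    equiv S (A'.pull f x) = (A.pull f).lTensor (InverseDifferent F F') (equiv T x)

/-! ### CM types and complex uniformization -/

/-- A CM type of `K`: a set of complex embeddings that contains exactly one out of each pair of
conjugate embeddings. -/
structure CMType (K : Type*) [Field K] [NumberField K] where
  /-- the embeddings in the type -/
  carrier : Finset (K →+* ℂ)
  conjugate_mem_iff : ∀ φ : K →+* ℂ, ComplexEmbedding.conjugate φ ∈ carrier ↔ φ ∉ carrier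

/-- The map `K → ℂ^Σ`, `x ↦ (σ(x))_σ`. -/
def CMType.embed {K : Type*} [Field K] [NumberField K] (Φ : CMType K) :
    K →+* (Φ.carrier → ℂ) :=
  RingHom.pi fun σ => σ.1

open Classical in
/-- The lift of a CM type `Σ` of `K` to an extension `K'`: all embeddings of `K'` that restrict to
an element of `Σ`. -/
def CMType.lift {K : Type*} [Field K] [NumberField K] (Φ : CMType K)
    (K' : Type*) [Field K'] [NumberField K'] [Algebra K K'] : CMType K' where
  carrier := Finset.univ.filter fun φ => φ.comp (algebraMap K K') ∈ Φ.carrier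
  conjugate_mem_iff φ := by
    simp only [Finset.mem_filter, Finset.mem_univ, true_and]
    exact Φ.conjugate_mem_iff (φ.comp (algebraMap K K'))

/-- `Spec ℂ` as a scheme over `k`, for a field `k` with a fixed embedding into `ℂ`. -/
def specComplex (k : Type) [Field k] [Algebra k ℂ] : Over (Spec (CommRingCat.of k)) :=
  Over.mk (Spec.map (CommRingCat.ofHom (algebraMap k ℂ)))

/-- The complex point `x` lies in the open subscheme `W`. -/
def ComplexPointMem {X : Scheme.{0}} (x : Spec (CommRingCat.of ℂ) ⟶ X) (W : X.Opens) : Prop :=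
  (⊤ : (Spec (CommRingCat.of ℂ)).Opens) ≤ x ⁻¹ᵁ W

open Classical in
/-- The value `f(x)` of a regular function `f` on `W` at a complex point `x` of `W` (and `0` at the
points outside `W`). -/
def complexValue {X : Scheme.{0}} (x : Spec (CommRingCat.of ℂ) ⟶ X) (W : X.Opens) (f : Γ(X, W)) :
    ℂ :=
  if h : ComplexPointMem x W then
    (Scheme.ΓSpecIso (CommRingCat.of ℂ)).hom (x.appLE W ⊤ h f)
  else 0

/-- The Hilbert-Blumenthal abelian variety `A` with complex multiplication `c` by `𝓞 K` is of type
`(K, Σ)` and corresponds to the fractional ideal `U`, that is, `A` is `X(U)`: there is an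
`𝓞 K`-equivariant isomorphism `ℂ^Σ / Σ(U) ≅ A(ℂ)` of complex Lie groups. The last two conditions
say that `ℂ^Σ → A(ℂ)` is holomorphic: preimages of Zariski open sets are open and regular functions
pull back to holomorphic functions. (A bijective holomorphic homomorphism from a complex torus onto
`A(ℂ)` is biholomorphic.) -/
def HBAV.CM.CorrespondsTo {k : Type} [Field k] [CharZero k] [Algebra k ℂ]
    {F : Type*} [Field F] [NumberField F] {A : HBAV k F}
    {K : Type*} [Field K] [NumberField K] [Algebra F K] (c : A.CM K)
    (Φ : CMType K) (U : FractionalIdeal (𝓞 K)⁰ K) : Prop :=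
  ∃ u : (Φ.carrier → ℂ) →+ A.Points (specComplex k),
    Function.Surjective u ∧
    (∀ z, u z = 0 ↔ ∃ x ∈ U, Φ.embed x = z) ∧
    (∀ (a : 𝓞 K) (z : Φ.carrier → ℂ),
      u (Φ.embed (algebraMap (𝓞 K) K a) * z) = c.onPoints (specComplex k) a (u z)) ∧
    (∀ W : A.X.left.Opens, IsOpen {z | ComplexPointMem (u z).hom.left W}) ∧
    (∀ (W : A.X.left.Opens) (f : Γ(A.X.left, W)),
      DifferentiableOn ℂ (fun z => complexValue (u z).hom.left W f)
        {z | ComplexPointMem (u z).hom.left W})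

end

noncomputable section

/-! ### Dual bases of fractional ideals for the trace form -/

section DualBasis

variable {F F' : Type*} [Field F] [NumberField F] [Field F'] [NumberField F'] [Algebra F F']

/-! The complex multiplication comes from the isomorphism `𝓞 F' ⊗ 𝓞 K ≃ 𝓞 K'` over `𝓞 F`. It is
surjective by the assumption on rings of integers, and injective because `K` is totally complex and
quadratic over `F` while `F'` is totally real, so that `1, α` stay independent over `F'` for `α ∈ K`
outside `F`. Hence `𝓞 K'` acts on `θ⁻¹ ⊗ A(T)`, the first factor through `θ⁻¹` and the second
through `A(T)`. This action is functorial in `T`, and Yoneda turns it into endomorphisms of the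
representing variety.

For the uniformization, one wants to tensor `ℂ^Σ → A(ℂ)` with `θ⁻¹` and to identify `θ⁻¹ ⊗ ℂ^Σ` with
`ℂ^Σ'`. The ideal `θ⁻¹` is projective over `𝓞 F`, hence has generators `t i` with dual functionals
`s i = Tr(b i * ·)` (`FractionalIdeal.exists_dual_basis`). Embeddings of `K'` above `σ` correspond
to embeddings of `F'` above `σ|F`, so independence of characters gives `∑ φ(t i) ψ(b i) = δ` on each
fibre (`sum_embeddings_dual_basis`). Thus `w ↦ ∑ t i ⊗ u(Tr(b i * w))`, where `Tr` sums over the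
fibres of `Σ' → Σ`, is the desired map. It is characterized by `x * z ↦ x ⊗ u z`
(`uniformization_embed_mul_inflate`), which yields surjectivity and equivariance. Contraction with
the `s j` shows that its kernel is the lattice of sums of products from `θ⁻¹` and `U`, that is
`U𝔇⁻¹`.

Holomorphy holds because the map is built from linear maps, `u`, morphisms `A → A'` and the group
law. Only the last needs work: holomorphy into a fibre product is tested on the two factors
(`IsHolomorphicFamily.of_isPullback`). -/

instance FractionalIdeal.module_finite_ringOfIntegers (I : FractionalIdeal (𝓞 F')⁰ F') :
    Module.Finite (𝓞 F) (I : Submodule (𝓞 F') F') := by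
  have : Module.Finite (𝓞 F') (I : Submodule (𝓞 F') F') :=
    Module.Finite.iff_fg.mpr (FractionalIdeal.fg_of_isNoetherianRing le_rfl I)
  exact Module.Finite.trans (𝓞 F') _

instance FractionalIdeal.isTorsionFree_ringOfIntegers (I : FractionalIdeal (𝓞 F')⁰ F') :
    Module.IsTorsionFree (𝓞 F) (I : Submodule (𝓞 F') F') :=
  .trans_faithfulSMul (𝓞 F) (𝓞 F') _

instance FractionalIdeal.projective_ringOfIntegers (I : FractionalIdeal (𝓞 F')⁰ F') :
    Module.Projective (𝓞 F) (I : Submodule (𝓞 F') F') := by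
  have : Module.FinitePresentation (𝓞 F) (I : Submodule (𝓞 F') F') :=
    Module.finitePresentation_of_finite _ _
  exact Module.Flat.projective_of_finitePresentation

/-- A functional on a fractional ideal of `F'` with values in `𝓞 F` is a trace form. -/
theorem FractionalIdeal.exists_trace_eq {I : FractionalIdeal (𝓞 F')⁰ F'} (hI : I ≠ 0)
    (s : (I : Submodule (𝓞 F') F') →ₗ[𝓞 F] 𝓞 F) :
    ∃ b : F', ∀ x : (I : Submodule (𝓞 F') F'),
      algebraMap (𝓞 F) F (s x) = Algebra.trace F F' (b * x) := by
  -- An integer `c` of the ideal moves a basis of integers `e j` into `I`; the functional is then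
  -- known on the `F`-basis `c * e j` of `F'`.
  obtain ⟨c, hc0, hc⟩ := FractionalIdeal.exists_ne_zero_mem_isInteger hI
  obtain ⟨J, e, he⟩ := FiniteDimensional.exists_is_basis_integral (𝓞 F) F F'
  have hmem (j) : algebraMap (𝓞 F') F' c * e j ∈ (I : Submodule (𝓞 F') F') := by
    obtain ⟨y, hy⟩ := IsIntegralClosure.isIntegral_iff (R := 𝓞 F) (A := 𝓞 F') |>.mp (he j)
    rw [← hy, mul_comm, ← Algebra.smul_def]
    exact Submodule.smul_mem _ _ hc
  have hc0' : algebraMap (𝓞 F') F' c ≠ 0 := by simpa using hc0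
  classical
  let S : F' →ₗ[F] F := e.constr F fun j => algebraMap (𝓞 F) F (s ⟨_, hmem j⟩)
  -- `S'` is the `F`-linear extension of `s`, since it sends `c * e j` to `s (c * e j)`;
  -- nondegeneracy of the trace form represents it by some `b`.
  let S' : F' →ₗ[F] F := S ∘ₗ LinearMap.mulLeft F (algebraMap (𝓞 F') F' c)⁻¹
  refine ⟨((Algebra.traceForm F F').toDual (traceForm_nondegenerate F F')).symm S', fun x => ?_⟩
  have := LinearMap.BilinForm.apply_toDual_symm_apply
    (hB := traceForm_nondegenerate F F') S' (x : F')
  rw [Algebra.traceForm_apply] at this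
  rw [this]
  set r := fun j => e.repr ((algebraMap (𝓞 F') F' c)⁻¹ * x) j
  obtain ⟨a, ha⟩ := IsLocalization.exist_integer_multiples (𝓞 F)⁰ Finset.univ r
  choose d hd using fun j => ha j (Finset.mem_univ j)
  have ha0 : algebraMap (𝓞 F) F a ≠ 0 := by simp
  have key : (a : 𝓞 F) • x = ∑ j, d j • (⟨_, hmem j⟩ : (I : Submodule (𝓞 F') F')) := by
    apply Subtype.ext
    have h1 : (x : F') = algebraMap (𝓞 F') F' c * ∑ j, r j • e j := by
      rw [e.sum_repr, mul_inv_cancel_left₀ hc0']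
    have h2 : (((a : 𝓞 F) • x : (I : Submodule (𝓞 F') F')) : F') = (a : 𝓞 F) • (x : F') := rfl
    have h3 (j) : ((d j • (⟨_, hmem j⟩ : (I : Submodule (𝓞 F') F')) :
      (I : Submodule (𝓞 F') F')) : F') = d j • (algebraMap (𝓞 F') F' c * e j) := rfl
    simp only [Submodule.coe_sum, h2, h3, h1, ← mul_smul_comm, ← Finset.mul_sum, Finset.smul_sum]
    congr 1
    refine Finset.sum_congr rfl fun j _ => ?_
    rw [← algebraMap_smul F (d j), hd, smul_assoc]
  have hx := congrArg (fun y => algebraMap (𝓞 F) F (s y)) key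
  simp only [map_smul, map_sum, smul_eq_mul, map_mul, hd] at hx
  apply mul_left_cancel₀ ha0
  rw [hx]
  have hS : S' x = ∑ j, r j • algebraMap (𝓞 F) F (s ⟨_, hmem j⟩) :=
    Module.Basis.constr_apply_fintype F e _ _
  rw [hS, Finset.mul_sum]
  refine Finset.sum_congr rfl fun j _ => ?_
  rw [smul_eq_mul, ← mul_assoc]
  exact congrArg (· * _) (Algebra.smul_def (a : 𝓞 F) (r j))

/-- A splitting of a surjection from a free module onto the projective module `I` gives the `t i`
and `s i`, and the `s i` are trace forms. The expansion is also needed on all of `F'`, where it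
follows by scaling an element into `I`. -/
theorem FractionalIdeal.exists_dual_basis {I : FractionalIdeal (𝓞 F')⁰ F'} (hI : I ≠ 0) :
    ∃ (n : ℕ) (t : Fin n → (I : Submodule (𝓞 F') F'))
      (s : Fin n → (I : Submodule (𝓞 F') F') →ₗ[𝓞 F] 𝓞 F) (b : Fin n → F'),
      (∀ x : F', ∑ i, Algebra.trace F F' (b i * x) • (t i : F') = x) ∧
      (∀ x, ∑ i, s i x • t i = x) ∧
      ∀ i x, algebraMap (𝓞 F) F (s i x) = Algebra.trace F F' (b i * x) := by
  obtain ⟨n, f, g, -, -, h⟩ := Module.Finite.exists_comp_eq_id_of_projective (𝓞 F)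
    (I : Submodule (𝓞 F') F')
  choose b hb using fun i => FractionalIdeal.exists_trace_eq hI (LinearMap.proj i ∘ₗ g)
  have hs (x) : ∑ i, (LinearMap.proj i ∘ₗ g) x • f (Pi.single i 1) = x := by
    have h1 : f (g x) = x := LinearMap.congr_fun h x
    rw [← Finset.univ_sum_single (g x), map_sum] at h1
    conv_rhs => rw [← h1]
    refine Finset.sum_congr rfl fun i _ => ?_
    rw [← map_smul, ← Pi.single_smul]
    simp
  refine ⟨n, fun i => f (Pi.single i 1), fun i => LinearMap.proj i ∘ₗ g, b, fun x => ?_, hs, hb⟩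
  obtain ⟨c, hc0, hc⟩ := FractionalIdeal.exists_ne_zero_mem_isInteger hI
  obtain ⟨a, ha0, y, hy⟩ : ∃ a : 𝓞 F, a ≠ 0 ∧ ∃ y : 𝓞 F', a • (algebraMap (𝓞 F') F' c)⁻¹ * x =
      algebraMap (𝓞 F') F' y := by
    obtain ⟨a, ha0, ha⟩ := exists_integral_multiples (𝓞 F) F {(algebraMap (𝓞 F') F' c)⁻¹ * x}
    replace ha := ha _ (Finset.mem_singleton_self _)
    obtain ⟨y, hy⟩ := IsIntegralClosure.isIntegral_iff (R := 𝓞 F) (A := 𝓞 F') |>.mp ha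
    exact ⟨a, ha0, y, by rw [hy, smul_mul_assoc]⟩
  have hc0' : algebraMap (𝓞 F') F' c ≠ 0 := by simpa using hc0
  have ha0' : algebraMap (𝓞 F) F a ≠ 0 := by simpa using ha0
  let x' : (I : Submodule (𝓞 F') F') := y • ⟨_, hc⟩
  have hx' : (x' : F') = algebraMap (𝓞 F) F a • x := by
    change y • algebraMap (𝓞 F') F' c = _
    rw [Algebra.smul_def, ← hy, algebraMap_smul]
    simp only [smul_mul_assoc]
    congr 1
    field_simp
  have h1 := congrArg (Subtype.val) (hs x')
  simp only [Submodule.coe_sum] at h1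
  have h2 (i) : (((LinearMap.proj i ∘ₗ g) x' • f (Pi.single i 1) : (I : Submodule (𝓞 F') F')) : F') =
      algebraMap (𝓞 F) F a • Algebra.trace F F' (b i * x) • (f (Pi.single i 1) : F') := by
    have h3 : algebraMap (𝓞 F) F a • Algebra.trace F F' (b i * x) =
        algebraMap (𝓞 F) F ((LinearMap.proj i ∘ₗ g) x') := by
      rw [hb, hx', mul_smul_comm, map_smul]
    rw [← smul_assoc, h3, algebraMap_smul]
    rfl
  simp only [h2, ← Finset.smul_sum, hx'] at h1
  exact smul_right_injective _ ha0' h1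

end DualBasis

/-! ### Embeddings of `K'` above an embedding of `K` -/

section CMExtension

variable {F F' K K' : Type*} [Field F] [NumberField F] [Field F'] [NumberField F']
  [Algebra F F'] [Field K] [NumberField K] [Algebra F K]
  [Field K'] [NumberField K'] [Algebra F K'] [Algebra F' K'] [Algebra K K']
  [IsScalarTower F F' K'] [IsScalarTower F K K']

omit [NumberField F'] [NumberField K] [NumberField K'] in
theorem RingHom.ext_of_adjoin_eq_top {E : Type*} [Field E]
    (hK' : IntermediateField.adjoin K (Set.range (algebraMap F' K')) = ⊤) {φ ψ : K' →+* E}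
    (h₁ : φ.comp (algebraMap K K') = ψ.comp (algebraMap K K'))
    (h₂ : φ.comp (algebraMap F' K') = ψ.comp (algebraMap F' K')) : φ = ψ := by
  let E' : IntermediateField K K' := (RingHom.eqLocusField φ ψ).toIntermediateField
    fun x => RingHom.congr_fun h₁ x
  have hE : IntermediateField.adjoin K (Set.range (algebraMap F' K')) ≤ E' := by
    rw [IntermediateField.adjoin_le_iff]
    rintro _ ⟨x, rfl⟩
    exact RingHom.congr_fun h₂ x
  rw [hK'] at hE
  ext x
  exact hE (IntermediateField.mem_top (x := x))

omit [NumberField F] in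
theorem exists_add_mul_eq_of_notMem_range [Algebra.IsQuadraticExtension F K] {α : K}
    (hα : α ∉ (algebraMap F K).range) (x : K) :
    ∃ p q : F, x = algebraMap F K p + algebraMap F K q * α := by
  have hli : LinearIndependent F ![1, α] := by
    rw [LinearIndependent.pair_iff' one_ne_zero]
    intro a ha
    exact hα ⟨a, by rw [← ha, Algebra.smul_def, mul_one]⟩
  have hspan := hli.span_eq_top_of_card_eq_finrank
    (by simp [Algebra.IsQuadraticExtension.finrank_eq_two F K])
  have hx : x ∈ Submodule.span F (Set.range ![1, α]) := hspan ▸ Submodule.mem_top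
  rw [Matrix.range_cons, Matrix.range_cons, Matrix.range_empty, Set.union_empty,
    Set.singleton_union, Submodule.mem_span_pair] at hx
  obtain ⟨p, q, h⟩ := hx
  exact ⟨p, q, by rw [← h, Algebra.smul_def, Algebra.smul_def, mul_one]⟩

omit [NumberField F] in
-- Otherwise `K = F(α)` would lie in `F'` inside `K'`, and an embedding of `K'` would be real on
-- `K`.
theorem algebraMap_notMem_range_of_notMem_range [IsTotallyReal F'] [IsTotallyComplex K]
    [Algebra.IsQuadraticExtension F K] {α : K} (hα : α ∉ (algebraMap F K).range) :
    algebraMap K K' α ∉ (algebraMap F' K').range := by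
  rintro ⟨β, hβ⟩
  obtain ⟨φ⟩ : Nonempty (K' →+* ℂ) := inferInstance
  have hreal (y : F') : star (φ (algebraMap F' K' y)) = φ (algebraMap F' K' y) := by
    exact RingHom.congr_fun (ComplexEmbedding.isReal_iff.mp
      (IsTotallyReal.complexEmbedding_isReal (φ.comp (algebraMap F' K')))) y
  have : ComplexEmbedding.IsReal (φ.comp (algebraMap K K')) := by
    rw [ComplexEmbedding.isReal_iff]
    ext x
    obtain ⟨p, q, rfl⟩ := exists_add_mul_eq_of_notMem_range hα x
    have hp (p : F) : algebraMap K K' (algebraMap F K p) = algebraMap F' K' (algebraMap F F' p) := by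
      rw [← IsScalarTower.algebraMap_apply, ← IsScalarTower.algebraMap_apply]
    have : algebraMap K K' (algebraMap F K p + algebraMap F K q * α) =
        algebraMap F' K' (algebraMap F F' p + algebraMap F F' q * β) := by
      simp only [map_add, map_mul, hp, hβ]
    simp only [RingHom.comp_apply, ComplexEmbedding.conjugate_coe_eq, this]
    exact hreal _
  exact IsTotallyComplex.complexEmbedding_not_isReal _ this

theorem exists_notMem_range_algebraMap [Algebra.IsQuadraticExtension F K] :
    ∃ α : K, α ∉ (algebraMap F K).range := by
  by_contra! h
  have h1 : Module.finrank F K = 1 :=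
    finrank_eq_one_iff'.mpr ⟨1, one_ne_zero, fun w => by
      obtain ⟨c, hc⟩ := h w
      exact ⟨c, by rw [← hc, Algebra.smul_def, mul_one]⟩⟩
  have h2 := Algebra.IsQuadraticExtension.finrank_eq_two F K
  omega

/-- Since `K` is not contained in `F'`, `[K' : F'] ≥ 2`; compare the two towers from `F` to `K'`.
This is the count that makes restriction of embeddings to `F'` surjective. -/
theorem finrank_le_finrank [IsTotallyReal F'] [IsTotallyComplex K]
    [Algebra.IsQuadraticExtension F K] : Module.finrank F F' ≤ Module.finrank K K' := by
  have h1 := Module.finrank_mul_finrank F F' K'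
  have h2 := Module.finrank_mul_finrank F K K'
  rw [Algebra.IsQuadraticExtension.finrank_eq_two] at h2
  have h3 : 2 ≤ Module.finrank F' K' := by
    obtain ⟨α, hα⟩ := exists_notMem_range_algebraMap (F := F) (K := K)
    by_contra! h
    have h4 : Module.finrank F' K' = 1 := by
      have := Module.finrank_pos (R := F') (M := K')
      omega
    obtain ⟨c, hc⟩ := exists_smul_eq_of_finrank_eq_one h4 one_ne_zero (algebraMap K K' α)
    refine algebraMap_notMem_range_of_notMem_range (F' := F') (K' := K') hα ⟨c, ?_⟩
    rw [← hc, Algebra.smul_def, mul_one]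
  nlinarith [Module.finrank_pos (R := F) (M := F')]

open Classical in
-- Restriction to `F'` maps embeddings above `σ` to embeddings above `σ|F`. It is injective because
-- `K` and `F'` generate `K'`, hence bijective by comparing degrees, and the sum is the usual
-- formula for the trace.
theorem sum_embeddings_eq_trace [IsTotallyReal F'] [IsTotallyComplex K]
    [Algebra.IsQuadraticExtension F K]
    (hK' : IntermediateField.adjoin K (Set.range (algebraMap F' K')) = ⊤)
    (σ : K →+* ℂ) (x : F') :
    ∑ φ : K' →+* ℂ with φ.comp (algebraMap K K') = σ, φ (algebraMap F' K' x) =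
      σ (algebraMap F K (Algebra.trace F F' x)) := by
  let _ : Algebra K ℂ := σ.toAlgebra
  let _ : Algebra F ℂ := (σ.comp (algebraMap F K)).toAlgebra
  let f (φ : K' →ₐ[K] ℂ) : F' →ₐ[F] ℂ :=
    { toRingHom := φ.toRingHom.comp (algebraMap F' K')
      commutes' := fun r => by
        change φ (algebraMap F' K' (algebraMap F F' r)) = σ (algebraMap F K r)
        rw [← IsScalarTower.algebraMap_apply, IsScalarTower.algebraMap_apply F K K']
        exact φ.commutes _ }
  have hf : Function.Injective f := fun φ ψ h => by
    apply AlgHom.coe_ringHom_injective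
    refine RingHom.ext_of_adjoin_eq_top hK' ?_ ?_
    · ext y
      exact (φ.commutes y).trans (ψ.commutes y).symm
    · exact congrArg (fun g : F' →ₐ[F] ℂ => (g : F' →+* ℂ)) h
  have hbij : Function.Bijective f := by
    refine hf.bijective_of_nat_card_le ?_
    rw [Nat.card_eq_fintype_card, Nat.card_eq_fintype_card, AlgHom.card, AlgHom.card]
    exact finrank_le_finrank
  have h := trace_eq_sum_embeddings ℂ (K := F) (L := F') (x := x)
  change σ (algebraMap F K (Algebra.trace F F' x)) = _ at h
  rw [h, ← Function.Bijective.sum_comp hbij (fun g : F' →ₐ[F] ℂ => g x)]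
  refine (Finset.sum_bij (fun (φ : K' →ₐ[K] ℂ) _ => (φ : K' →+* ℂ)) ?_ ?_ ?_ ?_).symm
  · intro φ _
    rw [Finset.mem_filter]
    exact ⟨Finset.mem_univ _, RingHom.ext φ.commutes⟩
  · intro φ _ ψ _ h
    exact AlgHom.coe_ringHom_injective h
  · intro φ hφ
    rw [Finset.mem_filter] at hφ
    exact ⟨⟨φ, fun r => RingHom.congr_fun hφ.2 r⟩, Finset.mem_univ _, rfl⟩
  · intro φ _
    rfl

open Classical in
/-- Dual bases of `F'` over `F` for the trace form remain dual on the embeddings of `K'` over a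
fixed embedding of `K`. -/
theorem sum_embeddings_dual_basis [IsTotallyReal F'] [IsTotallyComplex K]
    [Algebra.IsQuadraticExtension F K]
    (hK' : IntermediateField.adjoin K (Set.range (algebraMap F' K')) = ⊤)
    {n : ℕ} {t b : Fin n → F'}
    (htb : ∀ x : F', ∑ i, Algebra.trace F F' (b i * x) • t i = x)
    (φ ψ : K' →+* ℂ) (h : ψ.comp (algebraMap K K') = φ.comp (algebraMap K K')) :
    ∑ i, φ (algebraMap F' K' (t i)) * ψ (algebraMap F' K' (b i)) = if ψ = φ then 1 else 0 := by
  set σ := φ.comp (algebraMap K K') with hσ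
  let J := {ψ : K' →+* ℂ // ψ.comp (algebraMap K K') = σ}
  let χ (ψ : J) : F' →* ℂ := (ψ.1.comp (algebraMap F' K') : F' →+* ℂ)
  have hχ : Function.Injective χ := fun ψ₁ ψ₂ h => by
    refine Subtype.ext (RingHom.ext_of_adjoin_eq_top hK' (ψ₁.2.trans ψ₂.2.symm) ?_)
    ext x
    exact DFunLike.congr_fun h x
  have hli : LinearIndependent ℂ (fun ψ : J => (χ ψ : F' → ℂ)) :=
    (linearIndependent_monoidHom F' ℂ).comp χ hχ
  let c (ψ : J) : ℂ := ∑ i, φ (algebraMap F' K' (t i)) * ψ.1 (algebraMap F' K' (b i))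
  -- Applying `φ` to the expansion of `x` and writing each trace as a sum over `J` gives `φ(x) = ∑ c
  -- ψ * ψ(x)` on `F'`. The restrictions to `F'` are distinct characters, so the coefficients can be
  -- compared.
  have key : ∑ ψ : J, (c ψ - if ψ.1 = φ then 1 else 0) • (χ ψ : F' → ℂ) = 0 := by
    ext x
    have hx := congrArg (fun y => φ (algebraMap F' K' y)) (htb x)
    have hF (p : F) : φ (algebraMap F' K' (algebraMap F F' p)) = σ (algebraMap F K p) := by
      rw [← IsScalarTower.algebraMap_apply, IsScalarTower.algebraMap_apply F K K']
      rfl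
    simp only [map_sum, Algebra.smul_def, map_mul, hF, ← sum_embeddings_eq_trace hK' σ] at hx
    have h1 (f : (K' →+* ℂ) → ℂ) : ∑ ψ : K' →+* ℂ with ψ.comp (algebraMap K K') = σ, f ψ =
        ∑ ψ : J, f ψ.1 := by
      exact Finset.sum_subtype _ (by simp) _
    simp only [Finset.sum_apply, Pi.smul_apply, smul_eq_mul, sub_mul, Finset.sum_sub_distrib,
      ite_mul, one_mul, zero_mul, Pi.zero_apply]
    rw [Finset.sum_eq_single (⟨φ, rfl⟩ : J) (fun ψ _ h => if_neg fun h' => h (Subtype.ext h'))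
      (by simp), if_pos rfl]
    change _ - φ (algebraMap F' K' x) = 0
    rw [sub_eq_zero, ← hx]
    simp only [c, Finset.sum_mul, h1]
    rw [Finset.sum_comm]
    refine Finset.sum_congr rfl fun i _ => Finset.sum_congr rfl fun ψ _ => ?_
    change _ * ψ.1 (algebraMap F' K' x) = _
    ring
  have h2 := Fintype.linearIndependent_iff.mp hli _ key ⟨ψ, h⟩
  rw [sub_eq_zero] at h2
  exact h2

end CMExtension

/-! ### The isomorphism `𝓞 F' ⊗ 𝓞 K ≃ 𝓞 K'` -/

section IntegersTensor

variable (F F' K K' : Type*) [Field F] [Field F'] [Algebra F F'] [Field K] [Algebra F K]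
  [Field K'] [Algebra F K'] [Algebra F' K'] [Algebra K K']
  [IsScalarTower F F' K'] [IsScalarTower F K K']

/-- The multiplication map `𝓞 F' ⊗ 𝓞 K → 𝓞 K'`. -/
def ringOfIntegersTensorHom : 𝓞 F' ⊗[𝓞 F] 𝓞 K →ₐ[𝓞 F] 𝓞 K' :=
  Algebra.TensorProduct.productMap (IsScalarTower.toAlgHom (𝓞 F) (𝓞 F') (𝓞 K'))
    (IsScalarTower.toAlgHom (𝓞 F) (𝓞 K) (𝓞 K'))

variable {F F' K K'}

theorem ringOfIntegersTensorHom_tmul (x : 𝓞 F') (y : 𝓞 K) :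
    ringOfIntegersTensorHom F F' K K' (x ⊗ₜ y) =
      algebraMap (𝓞 F') (𝓞 K') x * algebraMap (𝓞 K) (𝓞 K') y := rfl

theorem ringOfIntegersTensorHom_surjective
    (hR' : (algebraMap (𝓞 K) (𝓞 K')).range ⊔ (algebraMap (𝓞 F') (𝓞 K')).range = ⊤) :
    Function.Surjective (ringOfIntegersTensorHom F F' K K') := by
  have : (algebraMap (𝓞 K) (𝓞 K')).range ⊔ (algebraMap (𝓞 F') (𝓞 K')).range ≤
      (ringOfIntegersTensorHom F F' K K').toRingHom.range := by
    refine sup_le ?_ ?_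
    · rintro _ ⟨y, rfl⟩
      exact ⟨1 ⊗ₜ y, by simp [ringOfIntegersTensorHom_tmul]⟩
    · rintro _ ⟨x, rfl⟩
      exact ⟨x ⊗ₜ 1, by simp [ringOfIntegersTensorHom_tmul]⟩
  rw [hR'] at this
  exact fun x => this (Subring.mem_top x)

variable [NumberField F] [NumberField F'] [NumberField K] [NumberField K']

theorem exists_integer_notMem_range_algebraMap [Algebra.IsQuadraticExtension F K] :
    ∃ α : 𝓞 K, (α : K) ∉ (algebraMap F K).range := by
  obtain ⟨β, hβ⟩ := exists_notMem_range_algebraMap (F := F) (K := K)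
  obtain ⟨a, ha0, ha⟩ := exists_integral_multiples (𝓞 F) F {β}
  obtain ⟨y, hy⟩ := IsIntegralClosure.isIntegral_iff (R := 𝓞 F) (A := 𝓞 K) |>.mp
    (ha _ (Finset.mem_singleton_self _))
  refine ⟨y, ?_⟩
  rintro ⟨c, hc⟩
  have ha0' : algebraMap (𝓞 F) F a ≠ 0 := by simpa using ha0
  refine hβ ⟨(algebraMap (𝓞 F) F a)⁻¹ * c, ?_⟩
  have hy' : (y : K) = algebraMap F K (algebraMap (𝓞 F) F a) * β := by
    rw [← Algebra.smul_def, algebraMap_smul]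
    exact hy
  rw [map_mul, hc, hy', map_inv₀, inv_mul_cancel_left₀ (by simpa using ha0')]

omit [NumberField F'] in
-- `1, α` is a basis of `K` over `F` but need not generate `𝓞 K` over `𝓞 F`, so coordinates exist
-- only after clearing a denominator.
theorem exists_smul_eq_add_of_tensor [Algebra.IsQuadraticExtension F K] {α : 𝓞 K}
    (hα : (α : K) ∉ (algebraMap F K).range) (x : 𝓞 F' ⊗[𝓞 F] 𝓞 K) :
    ∃ n : 𝓞 F, n ≠ 0 ∧ ∃ p q : 𝓞 F', n • x = p ⊗ₜ 1 + q ⊗ₜ α := by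
  induction x using TensorProduct.induction_on with
  | zero => exact ⟨1, one_ne_zero, 0, 0, by simp⟩
  | tmul y a =>
    obtain ⟨p, q, h⟩ := exists_add_mul_eq_of_notMem_range hα (a : K)
    obtain ⟨n, hn⟩ := IsLocalization.exist_integer_multiples (𝓞 F)⁰ Finset.univ ![p, q]
    obtain ⟨p', hp⟩ := hn 0 (Finset.mem_univ _)
    obtain ⟨q', hq⟩ := hn 1 (Finset.mem_univ _)
    refine ⟨n, nonZeroDivisors.coe_ne_zero n, p' • y, q' • y, ?_⟩
    have : (n : 𝓞 F) • a = p' • (1 : 𝓞 K) + q' • α := by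
      apply RingOfIntegers.coe_injective
      have h' : algebraMap (𝓞 K) K a = algebraMap F K p + algebraMap F K q * algebraMap (𝓞 K) K α :=
        h
      have hsmul (m : 𝓞 F) (c : 𝓞 K) : algebraMap (𝓞 K) K (m • c) =
          algebraMap F K (algebraMap (𝓞 F) F m) * algebraMap (𝓞 K) K c := by
        rw [Algebra.smul_def, map_mul]
        rfl
      have hn' (i) (r : 𝓞 F) (h : algebraMap (𝓞 F) F r = (n : 𝓞 F) • ![p, q] i) :
          algebraMap F K (algebraMap (𝓞 F) F r) =
            algebraMap F K (algebraMap (𝓞 F) F n) * algebraMap F K (![p, q] i) := by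
        rw [h, Algebra.smul_def, map_mul]
      rw [map_add, hsmul, hsmul, hsmul, hn' 0 p' hp, hn' 1 q' hq, h']
      simp
      ring
    rw [← TensorProduct.tmul_smul, this, TensorProduct.tmul_add, TensorProduct.smul_tmul,
      TensorProduct.smul_tmul]
  | add x y hx hy =>
    obtain ⟨n, hn, p, q, h⟩ := hx
    obtain ⟨n', hn', p', q', h'⟩ := hy
    refine ⟨n * n', mul_ne_zero hn hn', n' • p + n • p', n' • q + n • q', ?_⟩
    have h1 : (n * n') • x = n' • n • x := by rw [smul_smul, mul_comm]
    have h2 : (n * n') • y = n • n' • y := by rw [smul_smul]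
    rw [smul_add, h1, h2, h, h']
    simp only [smul_add, TensorProduct.add_tmul, TensorProduct.smul_tmul']
    abel

/-- A multiple of a kernel element is `p ⊗ 1 + q ⊗ α` with `p + q * α = 0` in `K'`; as `α ∉ F'`,
both coefficients vanish. The tensor product is flat, hence torsion-free, so the element itself is
zero. -/
theorem ringOfIntegersTensorHom_injective [IsTotallyReal F'] [IsTotallyComplex K]
    [Algebra.IsQuadraticExtension F K] :
    Function.Injective (ringOfIntegersTensorHom F F' K K') := by
  rw [injective_iff_map_eq_zero]
  intro x hx
  obtain ⟨α, hα⟩ := exists_integer_notMem_range_algebraMap (F := F) (K := K)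
  obtain ⟨n, hn, p, q, h⟩ := exists_smul_eq_add_of_tensor hα x
  have hα' := algebraMap_notMem_range_of_notMem_range (F' := F') (K' := K') hα
  have h1 := congrArg (ringOfIntegersTensorHom F F' K K') h
  rw [map_smul, hx, smul_zero, map_add, ringOfIntegersTensorHom_tmul,
    ringOfIntegersTensorHom_tmul, map_one, mul_one] at h1
  have h2 : (0 : K') = algebraMap F' K' p + algebraMap F' K' q * algebraMap K K' α :=
    congrArg (algebraMap (𝓞 K') K') h1
  have hq : q = 0 := by
    by_contra hq
    have hq' : algebraMap F' K' q ≠ 0 := by simpa using hq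
    refine hα' ⟨- (p : F') / q, ?_⟩
    rw [map_div₀, map_neg, div_eq_iff hq']
    linear_combination h2
  have hp : p = 0 := by
    rw [hq] at h2
    simpa using h2.symm
  rw [hp, hq, TensorProduct.zero_tmul, TensorProduct.zero_tmul, add_zero] at h
  have : Module.Flat (𝓞 F) (𝓞 F' ⊗[𝓞 F] 𝓞 K) := inferInstance
  have : Module.IsTorsionFree (𝓞 F) (𝓞 F' ⊗[𝓞 F] 𝓞 K) := inferInstance
  exact (smul_eq_zero_iff_right hn).mp h

/-- If `𝓞 K'` is generated by `𝓞 F'` and `𝓞 K`, then `𝓞 F' ⊗ 𝓞 K ≃ 𝓞 K'`. -/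
def ringOfIntegersTensorEquiv [IsTotallyReal F'] [IsTotallyComplex K]
    [Algebra.IsQuadraticExtension F K]
    (hR' : (algebraMap (𝓞 K) (𝓞 K')).range ⊔ (algebraMap (𝓞 F') (𝓞 K')).range = ⊤) :
    𝓞 F' ⊗[𝓞 F] 𝓞 K ≃ₐ[𝓞 F] 𝓞 K' :=
  AlgEquiv.ofBijective (ringOfIntegersTensorHom F F' K K')
    ⟨ringOfIntegersTensorHom_injective, ringOfIntegersTensorHom_surjective hR'⟩

end IntegersTensor

/-! ### Group homomorphisms detected on points -/

section GrpObj

open MonObj CartesianMonoidalCategory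

theorem isMonHom_of_mul_comp {C : Type*} [Category C] [CartesianMonoidalCategory C]
    {G H : C} [GrpObj G] [GrpObj H] (f : G ⟶ H)
    (h : ∀ {T : C} (x y : T ⟶ G), (x * y) ≫ f = (x ≫ f) * (y ≫ f)) : IsMonHom f where
  one_hom := by
    rw [MonObj.one_eq_one, MonObj.one_eq_one]
    have := h (1 : MonoidalCategoryStruct.tensorUnit C ⟶ G) 1
    rw [_root_.mul_one] at this
    exact left_eq_mul.mp this
  mul_hom := by
    rw [MonObj.mul_eq_mul, h, MonObj.mul_eq_mul, MonObj.comp_mul]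
    simp

end GrpObj

theorem GrpPoints.hom_mk {C : Type*} [Category C] {G T : C} (x : T ⟶ G) :
    (GrpPoints.mk x).hom = x := rfl

/-! ### Complex multiplication on `A ⊗ θ⁻¹` -/

namespace HBAV

variable {k : Type} [Field k] [CharZero k]
  {F F' K K' : Type*} [Field F] [NumberField F] [Field F'] [NumberField F'] [Algebra F F']
  [Field K] [NumberField K] [Algebra F K] [Field K'] [NumberField K']
  [Algebra F K'] [Algebra F' K'] [Algebra K K'] [IsScalarTower F F' K'] [IsScalarTower F K K']
  {A : HBAV k F}

/-- The action of `𝓞 K` on the points of an abelian variety with complex multiplication. -/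
def CM.pointsAlgHom (c : A.CM K) (T : Over (Spec (CommRingCat.of k))) :
    𝓞 K →ₐ[𝓞 F] Module.End (𝓞 F) (A.Points T) where
  toFun := c.onPoints T
  map_one' := LinearMap.ext fun x => congrArg (fun f => f x) (map_one (c.cm.toEnd T))
  map_mul' a b := LinearMap.ext fun x => congrArg (fun f => f x) (map_mul (c.cm.toEnd T) a b)
  map_zero' := LinearMap.ext fun x => congrArg (fun f => f x) (map_zero (c.cm.toEnd T))
  map_add' a b := LinearMap.ext fun x => congrArg (fun f => f x) (map_add (c.cm.toEnd T) a b)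
  commutes' a := LinearMap.ext fun x =>
    congrArg (fun f => GrpPoints.mk (x.hom ≫ f)) (c.cm_algebraMap a)

/-- The action of `𝓞 F' ⊗ 𝓞 K` on `θ⁻¹ ⊗ A(T)`. -/
def CM.tensorAction (F' : Type*) [Field F'] [NumberField F'] [Algebra F F'] (c : A.CM K)
    (T : Over (Spec (CommRingCat.of k))) :
    𝓞 F' ⊗[𝓞 F] 𝓞 K →ₐ[𝓞 F] Module.End (𝓞 F) (InverseDifferent F F' ⊗[𝓞 F] A.Points T) :=
  Algebra.TensorProduct.lift
    (Algebra.lsmul (𝓞 F) (𝓞 F) (InverseDifferent F F' ⊗[𝓞 F] A.Points T))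
    ((Module.End.lTensorAlgHom (𝓞 F) (A.Points T) (InverseDifferent F F')).comp (c.pointsAlgHom T))
    fun b a => by
      refine TensorProduct.ext' fun t x => ?_
      rfl

theorem CM.tensorAction_tmul (c : A.CM K) (T : Over (Spec (CommRingCat.of k))) (b : 𝓞 F')
    (a : 𝓞 K) (y : InverseDifferent F F' ⊗[𝓞 F] A.Points T) :
    c.tensorAction F' T (b ⊗ₜ a) y = b • (c.onPoints T a).lTensor (InverseDifferent F F') y := rfl

theorem CM.tensorAction_pull (c : A.CM K) {S T : Over (Spec (CommRingCat.of k))} (f : S ⟶ T)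
    (r : 𝓞 F' ⊗[𝓞 F] 𝓞 K) (y : InverseDifferent F F' ⊗[𝓞 F] A.Points T) :
    (A.pull f).lTensor (InverseDifferent F F') (c.tensorAction F' T r y) =
      c.tensorAction F' S r ((A.pull f).lTensor (InverseDifferent F F') y) := by
  induction r using TensorProduct.induction_on with
  | zero => simp
  | add r s hr hs => simp only [map_add, LinearMap.add_apply, hr, hs]
  | tmul b a =>
    induction y using TensorProduct.induction_on with
    | zero => simp
    | add y z hy hz => simp only [map_add, hy, hz]
    | tmul t x => rfl

/-- Evaluation at the universal point; the composite with `𝟙 _` is kept to match the shape of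
`equiv_comp_cmHom`. -/
theorem DifferentTwist.hom_ext {A' : HBAV k F'} (e : A.DifferentTwist A') {f g : A'.X ⟶ A'.X}
    (h : e.equiv A'.X (.mk (𝟙 _ ≫ f)) = e.equiv A'.X (.mk (𝟙 _ ≫ g))) : f = g := by
  have := congrArg GrpPoints.hom ((e.equiv A'.X).injective h)
  simpa only [GrpPoints.hom_mk, Category.id_comp] using this

section Twist

variable [IsTotallyReal F'] [IsTotallyComplex K] [Algebra.IsQuadraticExtension F K]
  (hR' : (algebraMap (𝓞 K) (𝓞 K')).range ⊔ (algebraMap (𝓞 F') (𝓞 K')).range = ⊤)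

/-- The action of `𝓞 K'` on `θ⁻¹ ⊗ A(T)`. -/
def CM.twistAction (c : A.CM K) (T : Over (Spec (CommRingCat.of k))) :
    𝓞 K' →ₐ[𝓞 F] Module.End (𝓞 F) (InverseDifferent F F' ⊗[𝓞 F] A.Points T) :=
  (c.tensorAction F' T).comp (ringOfIntegersTensorEquiv (F := F) (F' := F') hR').symm.toAlgHom

theorem CM.twistAction_mul (c : A.CM K) (T : Over (Spec (CommRingCat.of k))) (b : 𝓞 F') (a : 𝓞 K) :
    c.twistAction hR' T (algebraMap (𝓞 F') (𝓞 K') b * algebraMap (𝓞 K) (𝓞 K') a) =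
      c.tensorAction F' T (b ⊗ₜ a) :=
  congrArg (c.tensorAction F' T) (show (ringOfIntegersTensorEquiv (F := F) hR').symm _ = _ from (AlgEquiv.symm_apply_eq _).mpr
    (ringOfIntegersTensorHom_tmul b a).symm)

variable {A' : HBAV k F'} (e : A.DifferentTwist A') (c : A.CM K)

/-- The endomorphism of `A ⊗ θ⁻¹` given by an element of `𝓞 K'`. -/
def DifferentTwist.cmHom (r : 𝓞 K') : A'.X ⟶ A'.X :=
  ((e.equiv A'.X).symm (c.twistAction hR' A'.X r (e.equiv A'.X (.mk (𝟙 A'.X))))).hom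

/-- Every point is the pullback of the universal point `𝟙 A'.X` along itself, and the action
commutes with pullback. -/
theorem DifferentTwist.equiv_comp_cmHom {T : Over (Spec (CommRingCat.of k))} (r : 𝓞 K')
    (x : A'.Points T) :
    e.equiv T (.mk (x.hom ≫ e.cmHom hR' c r)) = c.twistAction hR' T r (e.equiv T x) := by
  change e.equiv T (A'.pull x.hom ((e.equiv A'.X).symm _)) = _
  rw [e.natural, LinearEquiv.apply_symm_apply]
  refine (c.tensorAction_pull _ _ _).trans ?_
  rw [← e.natural]
  change c.tensorAction F' T _ (e.equiv T (.mk (x.hom ≫ 𝟙 A'.X))) = _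
  rw [Category.comp_id]
  rfl

/-- The action of `𝓞 K'` on `A ⊗ θ⁻¹`. -/
def DifferentTwist.cmAction : GrpRingAction (𝓞 K') A'.X where
  act := e.cmHom hR' c
  isMonHom r := isMonHom_of_mul_comp _ fun {T} x y => by
    have h1 := e.equiv_comp_cmHom hR' c r (.mk x + .mk y)
    rw [map_add, map_add, ← e.equiv_comp_cmHom, ← e.equiv_comp_cmHom, ← map_add] at h1
    exact congrArg GrpPoints.hom ((e.equiv T).injective h1)
  act_one := by
    refine e.hom_ext ?_
    refine (e.equiv_comp_cmHom hR' c _ (.mk (𝟙 _))).trans ?_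
    rw [map_one, Category.id_comp]
    rfl
  act_mul r s := by
    refine e.hom_ext ?_
    refine (e.equiv_comp_cmHom hR' c _ (.mk (𝟙 _))).trans ?_
    rw [map_mul, Module.End.mul_apply, ← e.equiv_comp_cmHom, ← e.equiv_comp_cmHom]
    simp only [GrpPoints.hom_mk, Category.assoc]
  act_add r s := by
    refine e.hom_ext ?_
    refine (e.equiv_comp_cmHom hR' c _ (.mk (𝟙 _))).trans ?_
    rw [map_add, LinearMap.add_apply, ← e.equiv_comp_cmHom, ← e.equiv_comp_cmHom, ← map_add]
    simp only [GrpPoints.hom_mk, Category.id_comp]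
    rfl

theorem DifferentTwist.cmHom_algebraMap (b : 𝓞 F') :
    e.cmHom hR' c (algebraMap (𝓞 F') (𝓞 K') b) = A'.rm.act b := by
  refine e.hom_ext ?_
  refine (e.equiv_comp_cmHom hR' c _ (.mk (𝟙 _))).trans ?_
  have h := c.twistAction_mul hR' A'.X b 1
  rw [map_one, mul_one] at h
  rw [h, c.tensorAction_tmul]
  have h1 : c.onPoints A'.X 1 = LinearMap.id := map_one (c.pointsAlgHom A'.X)
  rw [h1, LinearMap.lTensor_id, LinearMap.id_apply, ← map_smul]
  rfl

/-- The complex multiplication by `𝓞 K'` on `A ⊗ θ⁻¹`. -/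
def DifferentTwist.cm : A'.CM K' where
  cm := e.cmAction hR' c
  cm_injective := by
    let ρ := (e.cmAction hR' c).toEnd A'.X
    -- In the domain `𝓞 K'`, integral over `𝓞 F'`, an ideal with zero contraction is zero; the
    -- contraction vanishes because the real multiplication on `A'` is faithful.
    have hker : RingHom.ker ρ = ⊥ := by
      refine Ideal.eq_bot_of_comap_eq_bot (R := 𝓞 F') (eq_bot_iff.mpr fun b hb => ?_)
      rw [Ideal.mem_comap, RingHom.mem_ker] at hb
      have h1 : GrpPoints.mk (𝟙 A'.X ≫ e.cmHom hR' c (algebraMap (𝓞 F') (𝓞 K') b)) =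
          (0 : A'.Points A'.X) :=
        congrArg (fun f : AddMonoid.End (GrpPoints A'.X A'.X) => f (.mk (𝟙 _))) hb
      have h2 : GrpPoints.mk (𝟙 A'.X ≫ A'.rm.act 0) = (0 : A'.Points A'.X) :=
        congrArg (fun f : AddMonoid.End (GrpPoints A'.X A'.X) => f (.mk (𝟙 _)))
          (map_zero (A'.rm.toEnd A'.X))
      rw [e.cmHom_algebraMap, ← h2] at h1
      have h3 := congrArg GrpPoints.hom h1
      simp only [GrpPoints.hom_mk, Category.id_comp] at h3
      exact A'.rm_injective h3
    intro r s h
    refine (RingHom.injective_iff_ker_eq_bot ρ).mpr hker (AddMonoidHom.ext fun x => ?_)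
    exact congrArg (fun f => GrpPoints.mk (x.hom ≫ f)) h
  cm_algebraMap := e.cmHom_algebraMap hR' c

theorem DifferentTwist.equiv_cm_onPoints (T : Over (Spec (CommRingCat.of k))) (r : 𝓞 K')
    (x : A'.Points T) :
    e.equiv T ((e.cm hR' c).onPoints T r x) = c.twistAction hR' T r (e.equiv T x) :=
  e.equiv_comp_cmHom hR' c r x

theorem DifferentTwist.equiv_cm_onPoints_algebraMap (T : Over (Spec (CommRingCat.of k))) (a : 𝓞 K)
    (x : A'.Points T) :
    e.equiv T ((e.cm hR' c).onPoints T (algebraMap (𝓞 K) (𝓞 K') a) x) =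
      (c.onPoints T a).lTensor (InverseDifferent F F') (e.equiv T x) := by
  have h := c.twistAction_mul (F' := F') hR' T 1 a
  rw [map_one, one_mul] at h
  rw [e.equiv_cm_onPoints, h, c.tensorAction_tmul, one_smul]

end Twist

end HBAV

/-! ### The lattice `U𝔇⁻¹` -/

section FractionalIdeal

variable {F F' K K' : Type*} [Field F] [NumberField F] [Field F'] [NumberField F']
  [Algebra F F'] [Field K] [NumberField K] [Algebra F K]
  [Field K'] [NumberField K'] [Algebra F' K'] [Algebra K K']

theorem inverseDifferent_ne_zero : inverseDifferent F F' ≠ 0 := by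
  refine inv_ne_zero (FractionalIdeal.coeIdeal_ne_zero.mpr differentIdeal_ne_bot)

theorem extendedHom_inverseDifferent :
    FractionalIdeal.extendedHom K' (𝓞 K') (inverseDifferent F F') =
      (((differentIdeal (𝓞 F) (𝓞 F')).map (algebraMap (𝓞 F') (𝓞 K')) : Ideal (𝓞 K')) :
        FractionalIdeal (𝓞 K')⁰ K')⁻¹ := by
  rw [inverseDifferent, map_inv₀, FractionalIdeal.extendedHom_coeIdeal_eq_map]

/-- If `𝓞 K'` is generated by `𝓞 F'` and `𝓞 K`, then the product of the extensions to `K'` of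
fractional ideals of `F'` and `K` is generated by products as an additive group. -/
theorem mem_extendedHom_mul_extendedHom_iff (F : Type*) {F' K K' : Type*} [Field F]
    [Field F'] [NumberField F'] [Algebra F F'] [Field K] [NumberField K] [Algebra F K]
    [Field K'] [NumberField K'] [Algebra F K'] [Algebra F' K'] [Algebra K K']
    [IsScalarTower F F' K'] [IsScalarTower F K K']
    (hR' : (algebraMap (𝓞 K) (𝓞 K')).range ⊔ (algebraMap (𝓞 F') (𝓞 K')).range = ⊤)
    (U : FractionalIdeal (𝓞 K)⁰ K) (I : FractionalIdeal (𝓞 F')⁰ F') (x : K') :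
    x ∈ FractionalIdeal.extendedHom K' (𝓞 K') U * FractionalIdeal.extendedHom K' (𝓞 K') I ↔
      x ∈ AddSubgroup.closure
        {z | ∃ t ∈ I, ∃ y ∈ U, algebraMap F' K' t * algebraMap K K' y = z} := by
  rw [← FractionalIdeal.mem_coe, FractionalIdeal.coe_mul, FractionalIdeal.coe_extendedHom_eq_span,
    FractionalIdeal.coe_extendedHom_eq_span, Submodule.span_mul_span]
  set C := AddSubgroup.closure
    {z | ∃ t ∈ I, ∃ y ∈ U, algebraMap F' K' t * algebraMap K K' y = z} with hC
  -- `𝓞 K'` is additively generated by products `b * a` with `b ∈ 𝓞 F'` and `a ∈ 𝓞 K`; `b` is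
  -- absorbed by `I` and `a` by `U`.
  have hsmul (r : 𝓞 K') (x : K') (hx : x ∈ C) : r • x ∈ C := by
    obtain ⟨z, rfl⟩ := ringOfIntegersTensorHom_surjective (F := F) hR' r
    induction z using TensorProduct.induction_on with
    | zero => simp
    | add z w hz hw => rw [map_add, add_smul]; exact add_mem hz hw
    | tmul b a =>
      induction hx using AddSubgroup.closure_induction with
      | mem x hx =>
        obtain ⟨t, ht, y, hy, rfl⟩ := hx
        refine AddSubgroup.subset_closure ⟨b • t, Submodule.smul_mem (I : Submodule (𝓞 F') F') b ht,
          a • y, Submodule.smul_mem (U : Submodule (𝓞 K) K) a hy, ?_⟩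
        rw [ringOfIntegersTensorHom_tmul, Algebra.smul_def, Algebra.smul_def, Algebra.smul_def]
        simp only [map_mul]
        have h1 : algebraMap (𝓞 K') K' (algebraMap (𝓞 F') (𝓞 K') b) =
          algebraMap F' K' (algebraMap (𝓞 F') F' b) := rfl
        have h2 : algebraMap (𝓞 K') K' (algebraMap (𝓞 K) (𝓞 K') a) =
          algebraMap K K' (algebraMap (𝓞 K) K a) := rfl
        rw [h1, h2]
        ring
      | zero => simp
      | add x y _ _ hx hy => rw [smul_add]; exact add_mem hx hy
      | neg x _ hx => rw [smul_neg]; exact neg_mem hx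
  constructor
  · intro hx
    induction hx using Submodule.span_induction with
    | mem x hx =>
      obtain ⟨_, ⟨y, hy, rfl⟩, _, ⟨t, ht, rfl⟩, rfl⟩ := hx
      exact AddSubgroup.subset_closure ⟨t, ht, y, hy, mul_comm _ _⟩
    | zero => exact zero_mem _
    | add x y _ _ hx hy => exact add_mem hx hy
    | smul r x _ hx => exact hsmul r x hx
  · intro hx
    induction hx using AddSubgroup.closure_induction with
    | mem x hx =>
      obtain ⟨t, ht, y, hy, rfl⟩ := hx
      exact Submodule.subset_span ⟨_, ⟨y, hy, rfl⟩, _, ⟨t, ht, rfl⟩, mul_comm _ _⟩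
    | zero => exact zero_mem _
    | add x y _ _ hx hy => exact add_mem hx hy
    | neg x _ hx => exact neg_mem hx

end FractionalIdeal

/-! ### Values of regular functions at complex points -/

section ComplexPoints

variable {X Y : Scheme.{0}}

/-- Evaluation at a complex point of an open subscheme. -/
def complexEval (x : Spec (CommRingCat.of ℂ) ⟶ X) (W : X.Opens) (h : ComplexPointMem x W) :
    Γ(X, W) →+* ℂ :=
  (Scheme.ΓSpecIso (CommRingCat.of ℂ)).hom.hom.comp (x.appLE W ⊤ h).hom

theorem complexValue_eq (x : Spec (CommRingCat.of ℂ) ⟶ X) {W : X.Opens} (h : ComplexPointMem x W)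
    (f : Γ(X, W)) : complexValue x W f = complexEval x W h f :=
  dif_pos h

theorem complexEval_appLE (x : Spec (CommRingCat.of ℂ) ⟶ X) (g : X ⟶ Y) {W : Y.Opens} {W' : X.Opens}
    (e : W' ≤ g ⁻¹ᵁ W) (h : ComplexPointMem x W') (h' : ComplexPointMem (x ≫ g) W) (f : Γ(Y, W)) :
    complexEval x W' h (g.appLE W W' e f) = complexEval (x ≫ g) W h' f := by
  exact congrArg (fun φ => (Scheme.ΓSpecIso (CommRingCat.of ℂ)).hom (φ f))
    (x.appLE_comp_appLE g W W' ⊤ e h)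

theorem complexEval_map (x : Spec (CommRingCat.of ℂ) ⟶ X) {W W' : X.Opens}
    (e : W' ≤ W) (h : ComplexPointMem x W') (h' : ComplexPointMem x W) (f : Γ(X, W)) :
    complexEval x W' h (X.presheaf.map (homOfLE e).op f) = complexEval x W h' f := by
  exact congrArg (fun φ => (Scheme.ΓSpecIso (CommRingCat.of ℂ)).hom (φ f))
    (x.map_appLE (h : ⊤ ≤ x ⁻¹ᵁ W') (homOfLE e).op)

theorem ComplexPointMem.mono {x : Spec (CommRingCat.of ℂ) ⟶ X} {W W' : X.Opens}
    (h : ComplexPointMem x W) (e : W ≤ W') : ComplexPointMem x W' :=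
  le_trans h (x.preimage_mono e)

theorem complexPointMem_inf_iff {x : Spec (CommRingCat.of ℂ) ⟶ X} {W W' : X.Opens} :
    ComplexPointMem x (W ⊓ W') ↔ ComplexPointMem x W ∧ ComplexPointMem x W' :=
  le_inf_iff (a := x ⁻¹ᵁ W) (b := x ⁻¹ᵁ W') (c := (⊤ : (Spec (CommRingCat.of ℂ)).Opens))

theorem complexPointMem_comp_iff {x : Spec (CommRingCat.of ℂ) ⟶ X} {g : X ⟶ Y} {W : Y.Opens} :
    ComplexPointMem (x ≫ g) W ↔ ComplexPointMem x (g ⁻¹ᵁ W) := Iff.rfl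

theorem complexPointMem_iff_mem {x : Spec (CommRingCat.of ℂ) ⟶ X} {W : X.Opens}
    (p : Spec (CommRingCat.of ℂ)) : ComplexPointMem x W ↔ x p ∈ W := by
  constructor
  · intro h
    exact h (Set.mem_univ p)
  · intro h q _
    have : Subsingleton (Spec (CommRingCat.of ℂ)) :=
      inferInstanceAs (Subsingleton (PrimeSpectrum ℂ))
    rw [Subsingleton.elim q p]
    exact h

theorem complexPointMem_basicOpen_iff {x : Spec (CommRingCat.of ℂ) ⟶ X} {W : X.Opens}
    (h : ComplexPointMem x W) (g : Γ(X, W)) :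
    ComplexPointMem x (X.basicOpen g) ↔ complexEval x W h g ≠ 0 := by
  constructor
  · intro h'
    rw [← complexEval_map x (X.basicOpen_le g) h' h]
    exact ((X.toRingedSpace.isUnit_res_basicOpen g).map (complexEval x _ h')).ne_zero
  · intro h'
    have hle : (⊤ : (Spec (CommRingCat.of ℂ)).Opens) ≤ x ⁻¹ᵁ W := h
    have hunit : IsUnit (x.appLE W ⊤ hle g) :=
      (isUnit_map_iff (Scheme.ΓSpecIso (CommRingCat.of ℂ)).commRingCatIsoToRingEquiv _).mp
        (IsUnit.mk0 _ h')
    have h1 : (Spec (CommRingCat.of ℂ)).basicOpen (x.appLE W ⊤ hle g) ≤ x ⁻¹ᵁ X.basicOpen g := by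
      rw [Scheme.Hom.appLE, CommRingCat.comp_apply, Scheme.basicOpen_res, Scheme.preimage_basicOpen]
      exact inf_le_right
    rw [Scheme.basicOpen_of_isUnit _ hunit] at h1
    exact h1

end ComplexPoints

/-! ### Functions on fibre products of affine schemes -/

section IsPushout

/-- The universal property gives a map from `D` to the generated subring, and by uniqueness its
composite with the inclusion is the identity. -/
theorem CommRingCat.closure_eq_top_of_isPushout {R B C D : CommRingCat.{0}} {f : R ⟶ B} {g : R ⟶ C}
    {i : B ⟶ D} {j : C ⟶ D} (h : IsPushout f g i j) :
    Subring.closure (Set.range i ∪ Set.range j) = ⊤ := by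
  set D₀ := Subring.closure (Set.range i ∪ Set.range j)
  let i₀ : B ⟶ CommRingCat.of D₀ := CommRingCat.ofHom
    (i.hom.codRestrict D₀ fun x => Subring.subset_closure (.inl ⟨x, rfl⟩))
  let j₀ : C ⟶ CommRingCat.of D₀ := CommRingCat.ofHom
    (j.hom.codRestrict D₀ fun x => Subring.subset_closure (.inr ⟨x, rfl⟩))
  let ι : CommRingCat.of D₀ ⟶ D := CommRingCat.ofHom D₀.subtype
  have hi : i₀ ≫ ι = i := rfl
  have hj : j₀ ≫ ι = j := rfl
  have hw : f ≫ i₀ = g ≫ j₀ := by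
    refine CommRingCat.hom_ext (RingHom.ext fun x => Subtype.ext ?_)
    exact (congrArg (fun φ : R ⟶ D => φ x) h.w)
  have hid : h.desc i₀ j₀ hw ≫ ι = 𝟙 D := by
    apply h.hom_ext
    · rw [h.inl_desc_assoc, hi, Category.comp_id]
    · rw [h.inr_desc_assoc, hj, Category.comp_id]
  rw [eq_top_iff]
  intro x _
  have := congrArg (fun φ : D ⟶ D => φ x) hid
  rw [← show _ = x from this]
  exact (h.desc i₀ j₀ hw x).2

end IsPushout

section Pullback

variable {P X Y Z : Scheme.{0}} {fst : P ⟶ X} {snd : P ⟶ Y} {f : X ⟶ Z} {g : Y ⟶ Z}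

theorem isAffineOpen_preimage_inf_preimage [IsAffine Z] (h : IsPullback fst snd f g)
    {U : X.Opens} (hU : IsAffineOpen U) {V : Y.Opens} (hV : IsAffineOpen V) :
    IsAffineOpen (fst ⁻¹ᵁ U ⊓ snd ⁻¹ᵁ V) := by
  have : IsAffine U := hU
  have : IsAffine V := hV
  have : IsAffine (⊤ : Z.Opens) := isAffineOpen_top Z
  exact .of_isPullback (Scheme.Hom.isPullback_resLE h (US := ⊤) (UT := V) (UX := U) le_top le_top
    rfl)

theorem closure_range_appLE_eq_top [IsAffine Z] (h : IsPullback fst snd f g)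
    {U : X.Opens} (hU : IsAffineOpen U) {V : Y.Opens} (hV : IsAffineOpen V) :
    Subring.closure (Set.range (fst.appLE U (fst ⁻¹ᵁ U ⊓ snd ⁻¹ᵁ V) inf_le_left) ∪
      Set.range (snd.appLE V (fst ⁻¹ᵁ U ⊓ snd ⁻¹ᵁ V) inf_le_right)) = ⊤ := by
  have : IsAffine U := hU
  have : IsAffine V := hV
  have : IsAffine (⊤ : Z.Opens) := isAffineOpen_top Z
  have := isPushout_appTop_of_isPullback
    (Scheme.Hom.isPullback_resLE h (US := ⊤) (UT := V) (UX := U) le_top le_top rfl)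
  have h1 := CommRingCat.closure_eq_top_of_isPushout this
  set W := fst ⁻¹ᵁ U ⊓ snd ⁻¹ᵁ V
  have hfst := (arrowResLEAppIso fst U W inf_le_left).hom.w
  have hsnd := (arrowResLEAppIso snd V W inf_le_right).hom.w
  have hsurj : Function.Surjective W.topIso.hom :=
    W.topIso.commRingCatIsoToRingEquiv.surjective
  rw [eq_top_iff]
  intro y _
  obtain ⟨y, rfl⟩ := hsurj y
  have hy := Subring.mem_map.mpr ⟨y, h1.symm ▸ Subring.mem_top y, (rfl : W.topIso.hom.hom y = _)⟩
  rw [RingHom.map_closure] at hy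
  refine Subring.closure_mono ?_ hy
  rintro _ ⟨_, ⟨x, rfl⟩ | ⟨x, rfl⟩, rfl⟩
  · exact .inl ⟨U.topIso.hom x, congrArg (fun φ => φ x) hfst⟩
  · exact .inr ⟨V.topIso.hom x, congrArg (fun φ => φ x) hsnd⟩

end Pullback

/-! ### Holomorphic families of complex points -/

section Holomorphic

variable {V V' : Type*} [NormedAddCommGroup V] [NormedSpace ℂ V]
  [NormedAddCommGroup V'] [NormedSpace ℂ V']
  {X Y P S : Scheme.{0}}

/-- A family of complex points of `X` depending holomorphically on a parameter: preimages of
Zariski open sets are open and regular functions pull back to holomorphic functions. -/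
structure IsHolomorphicFamily (v : V → (Spec (CommRingCat.of ℂ) ⟶ X)) : Prop where
  isOpen : ∀ W : X.Opens, IsOpen {z | ComplexPointMem (v z) W}
  differentiableOn : ∀ (W : X.Opens) (f : Γ(X, W)),
    DifferentiableOn ℂ (fun z => complexValue (v z) W f) {z | ComplexPointMem (v z) W}

theorem complexValue_comp (x : Spec (CommRingCat.of ℂ) ⟶ X) (g : X ⟶ Y) (W : Y.Opens)
    (f : Γ(Y, W)) : complexValue (x ≫ g) W f = complexValue x (g ⁻¹ᵁ W) (g.app W f) := by
  by_cases h : ComplexPointMem (x ≫ g) W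
  · rw [complexValue_eq _ h, complexValue_eq x (complexPointMem_comp_iff.mp h),
      Scheme.Hom.app_eq_appLE, complexEval_appLE x g le_rfl _ h]
  · rw [complexValue, complexValue, dif_neg h, dif_neg (complexPointMem_comp_iff.not.mp h)]

namespace IsHolomorphicFamily

theorem const (x : Spec (CommRingCat.of ℂ) ⟶ X) : IsHolomorphicFamily fun _ : V => x where
  isOpen _ := isOpen_const
  differentiableOn _ _ := differentiableOn_const _

theorem comp_hom {v : V → (Spec (CommRingCat.of ℂ) ⟶ X)} (hv : IsHolomorphicFamily v) (g : X ⟶ Y) :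
    IsHolomorphicFamily fun z => v z ≫ g where
  isOpen W := hv.isOpen (g ⁻¹ᵁ W)
  differentiableOn W f := by
    simp only [complexValue_comp]
    exact hv.differentiableOn (g ⁻¹ᵁ W) (g.app W f)

theorem comp_differentiable {v : V → (Spec (CommRingCat.of ℂ) ⟶ X)} (hv : IsHolomorphicFamily v)
    {L : V' → V} (hL : Differentiable ℂ L) : IsHolomorphicFamily fun z => v (L z) where
  isOpen W := (hv.isOpen W).preimage hL.continuous
  differentiableOn W f := (hv.differentiableOn W f).comp hL.differentiableOn fun _ h => h

/-- Holomorphy may be checked on an affine open neighbourhood of each point and for its regular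
functions. -/
theorem of_affine {v : V → (Spec (CommRingCat.of ℂ) ⟶ X)}
    (h : ∀ z₀, ∃ U : X.Opens, IsAffineOpen U ∧ ComplexPointMem (v z₀) U ∧
      IsOpen {z | ComplexPointMem (v z) U} ∧ ∀ f : Γ(X, U),
        DifferentiableOn ℂ (fun z => complexValue (v z) U f) {z | ComplexPointMem (v z) U}) :
    IsHolomorphicFamily v := by
  have key (W : X.Opens) (f : Γ(X, W)) (z₀ : V) (hz₀ : ComplexPointMem (v z₀) W) :
      ∃ N : Set V, IsOpen N ∧ z₀ ∈ N ∧ N ⊆ {z | ComplexPointMem (v z) W} ∧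
        DifferentiableOn ℂ (fun z => complexValue (v z) W f) N := by
    obtain ⟨U, hU, hzU, hopen, hdiff⟩ := h z₀
    obtain ⟨p⟩ : Nonempty (Spec (CommRingCat.of ℂ)) := inferInstance
    -- On a basic open set inside `W`, `f` becomes a fraction `a / g ^ m` of functions on `U`, so
    -- its values are a quotient of holomorphic functions with nonvanishing denominator.
    obtain ⟨g, hgW, hg⟩ := hU.exists_basicOpen_le
      ⟨v z₀ p, (complexPointMem_iff_mem p).mp hz₀⟩ ((complexPointMem_iff_mem p).mp hzU)
    have hloc := hU.isLocalization_basicOpen g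
    obtain ⟨m, a, ha⟩ := IsLocalization.Away.surj g (X.presheaf.map (homOfLE hgW).op f)
    have hmem {z : V} : ComplexPointMem (v z) (X.basicOpen g) ↔
        z ∈ {z | ComplexPointMem (v z) U} ∩ (fun z => complexValue (v z) U g) ⁻¹' {0}ᶜ := by
      constructor
      · intro hz
        have hz' := hz.mono (X.basicOpen_le g)
        refine ⟨hz', ?_⟩
        rw [Set.mem_preimage, Set.mem_compl_singleton_iff, complexValue_eq _ hz']
        exact (complexPointMem_basicOpen_iff hz' g).mp hz
      · rintro ⟨hz, hz'⟩
        rw [Set.mem_preimage, Set.mem_compl_singleton_iff, complexValue_eq _ hz] at hz'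
        exact (complexPointMem_basicOpen_iff hz g).mpr hz'
    refine ⟨{z | ComplexPointMem (v z) U} ∩ (fun z => complexValue (v z) U g) ⁻¹' {0}ᶜ,
      (hdiff g).continuousOn.isOpen_inter_preimage hopen isOpen_compl_singleton,
      hmem.mp ((complexPointMem_iff_mem p).mpr hg), fun z hz => (hmem.mpr hz).mono hgW, ?_⟩
    refine DifferentiableOn.congr (f := fun z => complexValue (v z) U a *
      (complexValue (v z) U g ^ m)⁻¹) ?_ ?_
    · exact ((hdiff a).mono Set.inter_subset_left).fun_mul
        ((((hdiff g).mono Set.inter_subset_left).fun_pow m).fun_inv fun z hz => pow_ne_zero m hz.2)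
    · intro z hz
      have hzg := hmem.mpr hz
      have hzU := hz.1
      have hz0 : complexValue (v z) U g ≠ 0 := hz.2
      rw [eq_mul_inv_iff_mul_eq₀ (pow_ne_zero m hz0), complexValue_eq _ (hzg.mono hgW), complexValue_eq _ hzU,
        complexValue_eq _ hzU, ← complexEval_map (v z) hgW hzg, ← complexEval_map (v z)
        (X.basicOpen_le g) hzg hzU, ← complexEval_map (v z) (X.basicOpen_le g) hzg hzU,
        ← map_pow, ← map_mul]
      exact congrArg _ ha
  constructor
  · intro W
    rw [isOpen_iff_forall_mem_open]
    intro z hz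
    obtain ⟨N, hN, hzN, hNW, -⟩ := key W 0 z hz
    exact ⟨N, hNW, hN, hzN⟩
  · intro W f z hz
    obtain ⟨N, hN, hzN, hNW, hd⟩ := key W f z hz
    exact ((hd z hzN).differentiableAt (hN.mem_nhds hzN)).differentiableWithinAt

/-- Near any parameter, work on an affine box `A × B`. The functions on it with holomorphic pullback
form a subring containing those from both factors, and these generate. -/
theorem of_isPullback [IsAffine S] {fst : P ⟶ X} {snd : P ⟶ Y} {f : X ⟶ S} {g : Y ⟶ S}
    (h : IsPullback fst snd f g) {v : V → (Spec (CommRingCat.of ℂ) ⟶ P)}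
    (h₁ : IsHolomorphicFamily fun z => v z ≫ fst) (h₂ : IsHolomorphicFamily fun z => v z ≫ snd) :
    IsHolomorphicFamily v := by
  refine of_affine fun z₀ => ?_
  obtain ⟨p⟩ : Nonempty (Spec (CommRingCat.of ℂ)) := inferInstance
  obtain ⟨_, ⟨A, hA, rfl⟩, hzA, -⟩ :=
    X.isBasis_affineOpens.exists_subset_of_mem_open (Set.mem_univ ((v z₀ ≫ fst) p)) isOpen_univ
  obtain ⟨_, ⟨B, hB, rfl⟩, hzB, -⟩ :=
    Y.isBasis_affineOpens.exists_subset_of_mem_open (Set.mem_univ ((v z₀ ≫ snd) p)) isOpen_univ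
  have hset : {z | ComplexPointMem (v z) (fst ⁻¹ᵁ A ⊓ snd ⁻¹ᵁ B)} =
      {z | ComplexPointMem (v z ≫ fst) A} ∩ {z | ComplexPointMem (v z ≫ snd) B} :=
    Set.ext fun z => complexPointMem_inf_iff
  refine ⟨_, isAffineOpen_preimage_inf_preimage h hA hB, ?_, ?_, fun q => ?_⟩
  · exact complexPointMem_inf_iff.mpr
      ⟨(complexPointMem_iff_mem p).mpr hzA, (complexPointMem_iff_mem p).mpr hzB⟩
  · rw [hset]
    exact (h₁.isOpen A).inter (h₂.isOpen B)
  · have hq : q ∈ Subring.closure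
        (Set.range (fst.appLE A (fst ⁻¹ᵁ A ⊓ snd ⁻¹ᵁ B) inf_le_left) ∪
          Set.range (snd.appLE B (fst ⁻¹ᵁ A ⊓ snd ⁻¹ᵁ B) inf_le_right)) := by
      rw [closure_range_appLE_eq_top h hA hB]
      exact Subring.mem_top q
    induction hq using Subring.closure_induction with
    | mem q hq =>
      obtain ⟨a, rfl⟩ | ⟨b, rfl⟩ := hq
      · refine ((h₁.differentiableOn A a).mono (hset ▸ Set.inter_subset_left)).congr fun z hz => ?_
        have hz' : ComplexPointMem (v z ≫ fst) A := (complexPointMem_inf_iff.mp hz).1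
        rw [complexValue_eq _ hz, complexValue_eq _ hz', complexEval_appLE _ _ _ _ hz']
      · refine ((h₂.differentiableOn B b).mono (hset ▸ Set.inter_subset_right)).congr fun z hz => ?_
        have hz' : ComplexPointMem (v z ≫ snd) B := (complexPointMem_inf_iff.mp hz).2
        rw [complexValue_eq _ hz, complexValue_eq _ hz', complexEval_appLE _ _ _ _ hz']
    | zero =>
      refine (differentiableOn_const 0).congr fun z hz => ?_
      rw [complexValue_eq _ hz, map_zero]
    | one =>
      refine (differentiableOn_const 1).congr fun z hz => ?_
      rw [complexValue_eq _ hz, map_one]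
    | add a b _ _ ha hb =>
      refine (ha.add hb).congr fun z hz => ?_
      simp only [Pi.add_apply, complexValue_eq _ hz, map_add]
    | neg a _ ha =>
      refine ha.neg.congr fun z hz => ?_
      simp only [Pi.neg_apply, complexValue_eq _ hz, map_neg]
    | mul a b _ _ ha hb =>
      refine (ha.mul hb).congr fun z hz => ?_
      simp only [Pi.mul_apply, complexValue_eq _ hz, map_mul]

end IsHolomorphicFamily

open MonObj CartesianMonoidalCategory

/-- Sums of holomorphic families of complex points of a group scheme are holomorphic. -/
theorem IsHolomorphicFamily.add {k : Type} [Field k] [Algebra k ℂ]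
    {G : Over (Spec (CommRingCat.of k))} [GrpObj G] [IsCommMonObj G]
    {v w : V → GrpPoints G (specComplex k)}
    (hv : IsHolomorphicFamily fun z => (v z).hom.left)
    (hw : IsHolomorphicFamily fun z => (w z).hom.left) :
    IsHolomorphicFamily fun z => (v z + w z).hom.left := by
  have hP : IsPullback (fst G G).left (snd G G).left G.hom G.hom :=
    IsPullback.of_hasPullback G.hom G.hom
  have h : IsHolomorphicFamily fun z => (lift (v z).hom (w z).hom).left := by
    refine .of_isPullback hP ?_ ?_
    · have h1 (z : V) : (lift (v z).hom (w z).hom).left ≫ (fst G G).left = (v z).hom.left := by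
        rw [← Over.comp_left, lift_fst]
      exact Eq.mpr (congrArg IsHolomorphicFamily (funext h1)) hv
    · have h1 (z : V) : (lift (v z).hom (w z).hom).left ≫ (snd G G).left = (w z).hom.left := by
        rw [← Over.comp_left, lift_snd]
      exact Eq.mpr (congrArg IsHolomorphicFamily (funext h1)) hw
  exact h.comp_hom (μ[G]).left

theorem IsHolomorphicFamily.sum {k : Type} [Field k] [Algebra k ℂ]
    {G : Over (Spec (CommRingCat.of k))} [GrpObj G] [IsCommMonObj G] {J : Type*} (s : Finset J)
    {v : J → V → GrpPoints G (specComplex k)}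
    (hv : ∀ i ∈ s, IsHolomorphicFamily fun z => (v i z).hom.left) :
    IsHolomorphicFamily fun z => (∑ i ∈ s, v i z).hom.left := by
  classical
  induction s using Finset.induction_on with
  | empty => exact .const _
  | insert i s his ih =>
    simp only [Finset.sum_insert his]
    exact .add (hv i (Finset.mem_insert_self i s))
      (ih fun j hj => hv j (Finset.mem_insert_of_mem hj))

end Holomorphic

/-! ### Comparison of `ℂ^Σ` and `ℂ^Σ'` -/

namespace CMType

variable {F F' K K' : Type*} [Field F] [NumberField F] [Field F'] [NumberField F']
  [Algebra F F'] [Field K] [NumberField K] [Algebra F K]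
  [Field K'] [NumberField K'] [Algebra F K'] [Algebra F' K'] [Algebra K K']
  [IsScalarTower F F' K'] [IsScalarTower F K K']

theorem mem_lift_carrier {Φ : CMType K} {φ : K' →+* ℂ} :
    φ ∈ (Φ.lift K').carrier ↔ φ.comp (algebraMap K K') ∈ Φ.carrier := by
  simp [lift]

variable (K') in
/-- The map `ℂ^Σ → ℂ^Σ'` induced by restriction of embeddings. -/
def inflate (Φ : CMType K) : (Φ.carrier → ℂ) →+* ((Φ.lift K').carrier → ℂ) :=
  RingHom.pi fun φ => Pi.evalRingHom _ ⟨φ.1.comp (algebraMap K K'), mem_lift_carrier.mp φ.2⟩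

theorem embed_algebraMap (Φ : CMType K) (y : K) :
    (Φ.lift K').embed (algebraMap K K' y) = Φ.inflate K' (Φ.embed y) := rfl

open Classical in
variable (K') in
/-- The map `ℂ^Σ' → ℂ^Σ` given by summation over the embeddings of `K'` above those of `K`. -/
def deflate (Φ : CMType K) : ((Φ.lift K').carrier → ℂ) →ₗ[ℂ] (Φ.carrier → ℂ) where
  toFun w σ := ∑ φ : {φ : K' →+* ℂ // φ.comp (algebraMap K K') = σ.1},
    w ⟨φ.1, mem_lift_carrier.mpr (by rw [φ.2]; exact σ.2)⟩
  map_add' w w' := by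
    ext σ
    exact Finset.sum_add_distrib
  map_smul' a w := by
    ext σ
    exact Finset.mul_sum _ _ _ |>.symm

/-- The projection formula: an inflated vector is constant on the fibres of `Σ' → Σ`. -/
theorem deflate_mul_inflate (Φ : CMType K) (w : (Φ.lift K').carrier → ℂ) (z : Φ.carrier → ℂ) :
    Φ.deflate K' (w * Φ.inflate K' z) = Φ.deflate K' w * z := by
  ext σ
  refine (Finset.sum_congr rfl fun φ _ => ?_).trans (Finset.sum_mul _ _ _).symm
  change w _ * z _ = w _ * z _
  congr 2
  exact Subtype.ext φ.2

variable [IsTotallyReal F'] [IsTotallyComplex K] [Algebra.IsQuadraticExtension F K]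
  (hK' : IntermediateField.adjoin K (Set.range (algebraMap F' K')) = ⊤)

include hK' in
theorem deflate_embed (Φ : CMType K) (x : F') :
    Φ.deflate K' ((Φ.lift K').embed (algebraMap F' K' x)) =
      Φ.embed (algebraMap F K (Algebra.trace F F' x)) := by
  classical
  ext σ
  refine Eq.trans ?_ (sum_embeddings_eq_trace hK' σ.1 x)
  exact (Finset.sum_subtype _ (by simp) (fun φ : K' →+* ℂ => φ (algebraMap F' K' x))).symm

include hK' in
-- In coordinate `φ`, only the `ψ` with the same restriction to `K` contribute, and `w ψ` has
-- coefficient `∑ φ(t i) ψ(b i) = δ`.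
theorem sum_embed_mul_inflate_deflate (Φ : CMType K) {n : ℕ} {t b : Fin n → F'}
    (htb : ∀ x : F', ∑ i, Algebra.trace F F' (b i * x) • t i = x)
    (w : (Φ.lift K').carrier → ℂ) :
    ∑ i, (Φ.lift K').embed (algebraMap F' K' (t i)) *
      Φ.inflate K' (Φ.deflate K' ((Φ.lift K').embed (algebraMap F' K' (b i)) * w)) = w := by
  classical
  ext φ
  rw [Finset.sum_apply]
  change ∑ i, φ.1 (algebraMap F' K' (t i)) *
    ∑ ψ : {ψ : K' →+* ℂ // ψ.comp (algebraMap K K') = φ.1.comp (algebraMap K K')},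
      ψ.1 (algebraMap F' K' (b i)) * w ⟨ψ.1, _⟩ = w φ
  simp only [Finset.mul_sum, ← mul_assoc]
  rw [Finset.sum_comm]
  simp only [← Finset.sum_mul]
  rw [Finset.sum_eq_single ⟨φ.1, rfl⟩]
  · rw [sum_embeddings_dual_basis hK' htb φ.1 φ.1 rfl, if_pos rfl, one_mul]
  · intro ψ _ h
    rw [sum_embeddings_dual_basis hK' htb φ.1 ψ.1 ψ.2, if_neg fun h' => h (Subtype.ext h'),
      zero_mul]
  · simp

end CMType

/-! ### The uniformization of `A ⊗ θ⁻¹` -/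

namespace HBAV

variable {k : Type} [Field k] [CharZero k]
  {F F' K K' : Type*} [Field F] [NumberField F] [Field F'] [NumberField F'] [Algebra F F']
  [Field K] [NumberField K] [Algebra F K] [Field K'] [NumberField K']
  [Algebra F K'] [Algebra F' K'] [Algebra K K'] [IsScalarTower F F' K'] [IsScalarTower F K K']
  {A : HBAV k F} {A' : HBAV k F'} (e : A.DifferentTwist A')

/-- The homomorphism `A → A ⊗ θ⁻¹`, `x ↦ t ⊗ x`. -/
def DifferentTwist.tmulHom (t : InverseDifferent F F') : A.X ⟶ A'.X :=
  ((e.equiv A.X).symm (t ⊗ₜ GrpPoints.mk (𝟙 A.X))).hom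

/-- By naturality, tensoring with `t` on complex points comes from a morphism of schemes; this is
what makes it holomorphic. -/
theorem DifferentTwist.equiv_symm_tmul (T : Over (Spec (CommRingCat.of k)))
    (t : InverseDifferent F F') (x : A.Points T) :
    (e.equiv T).symm (t ⊗ₜ x) = GrpPoints.mk (x.hom ≫ e.tmulHom t) := by
  rw [LinearEquiv.symm_apply_eq]
  change _ = e.equiv T (A'.pull x.hom ((e.equiv A.X).symm _))
  rw [e.natural, LinearEquiv.apply_symm_apply, LinearMap.lTensor_tmul]
  change _ = t ⊗ₜ GrpPoints.mk (x.hom ≫ 𝟙 A.X)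
  rw [Category.comp_id]
  rfl

section Uniformization

variable [Algebra k ℂ] (c : A.CM K) {Φ : CMType K}

/-- The uniformization of `A ⊗ θ⁻¹` induced by one of `A` and dual bases of `F'` over `F`. -/
def DifferentTwist.uniformization (u : (Φ.carrier → ℂ) →+ A.Points (specComplex k)) {n : ℕ}
    (t : Fin n → InverseDifferent F F') (b : Fin n → F') :
    ((Φ.lift K').carrier → ℂ) →+ A'.Points (specComplex k) where
  toFun w := ∑ i, (e.equiv (specComplex k)).symm (t i ⊗ₜ
    u (Φ.deflate K' ((Φ.lift K').embed (algebraMap F' K' (b i)) * w)))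
  map_zero' := by simp
  map_add' w w' := by
    simp only [mul_add, map_add, TensorProduct.tmul_add, Finset.sum_add_distrib]

variable [IsTotallyReal F'] [IsTotallyComplex K] [Algebra.IsQuadraticExtension F K]
  (hK' : IntermediateField.adjoin K (Set.range (algebraMap F' K')) = ⊤)
  (hR' : (algebraMap (𝓞 K) (𝓞 K')).range ⊔ (algebraMap (𝓞 F') (𝓞 K')).range = ⊤)
  {u : (Φ.carrier → ℂ) →+ A.Points (specComplex k)}
  (hu : ∀ (a : 𝓞 K) (z : Φ.carrier → ℂ),
      u (Φ.embed (algebraMap (𝓞 K) K a) * z) = c.onPoints (specComplex k) a (u z))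
  {n : ℕ} {t : Fin n → InverseDifferent F F'}
  {s : Fin n → InverseDifferent F F' →ₗ[𝓞 F] 𝓞 F} {b : Fin n → F'}
  (htb : ∀ x : F', ∑ i, Algebra.trace F F' (b i * x) • (t i : F') = x)
  (hts : ∀ x, ∑ i, s i x • t i = x)
  (hsb : ∀ i x, algebraMap (𝓞 F) F (s i x) = Algebra.trace F F' (b i * x))

omit [IsTotallyComplex K] [Algebra.IsQuadraticExtension F K] in
include hu in
theorem map_embed_algebraMap_mul (a : 𝓞 F) (z : Φ.carrier → ℂ) :
    u (Φ.embed (algebraMap F K (algebraMap (𝓞 F) F a)) * z) = a • u z :=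
  (hu (algebraMap (𝓞 F) (𝓞 K) a) z).trans
    (congrArg (fun f => GrpPoints.mk ((u z).hom ≫ f)) (c.cm_algebraMap a))

include hK' hsb in
omit [CharZero k] in
theorem deflate_embed_mul_embed_mul_inflate (i : Fin n) (x : InverseDifferent F F')
    (z : Φ.carrier → ℂ) :
    Φ.deflate K' ((Φ.lift K').embed (algebraMap F' K' (b i)) *
      ((Φ.lift K').embed (algebraMap F' K' x) * Φ.inflate K' z)) =
      Φ.embed (algebraMap F K (algebraMap (𝓞 F) F (s i x))) * z := by
  rw [← mul_assoc, ← map_mul, ← map_mul, Φ.deflate_mul_inflate, Φ.deflate_embed (F := F) hK', hsb]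

include hK' hu hts hsb in
-- The `i`-th component is `t i ⊗ u (s i x * z)`; moving `s i x ∈ 𝓞 F` across the tensor product
-- reassembles `x`. This formula no longer involves the dual basis.
theorem DifferentTwist.uniformization_embed_mul_inflate (x : InverseDifferent F F')
    (z : Φ.carrier → ℂ) :
    e.uniformization u t b ((Φ.lift K').embed (algebraMap F' K' x) * Φ.inflate K' z) =
      (e.equiv (specComplex k)).symm (x ⊗ₜ u z) := by
  change ∑ i, (e.equiv (specComplex k)).symm (t i ⊗ₜ u _) = _
  rw [← map_sum]
  congr 1
  conv_rhs => rw [← hts x, TensorProduct.sum_tmul]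
  refine Finset.sum_congr rfl fun i _ => ?_
  rw [deflate_embed_mul_embed_mul_inflate hK' hsb, map_embed_algebraMap_mul c hu,
    TensorProduct.smul_tmul]

include hK' hu hts hsb in
theorem DifferentTwist.uniformization_surjective (hsurj : Function.Surjective u) :
    Function.Surjective (e.uniformization (K' := K') u t b) := by
  intro y
  rw [← AddMonoidHom.mem_range, ← (e.equiv (specComplex k)).symm_apply_apply y]
  induction e.equiv (specComplex k) y using TensorProduct.induction_on with
  | zero => rw [map_zero]; exact zero_mem _
  | add y z hy hz => rw [map_add]; exact add_mem hy hz
  | tmul x y =>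
    obtain ⟨z, rfl⟩ := hsurj y
    exact ⟨_, e.uniformization_embed_mul_inflate c hK' hu hts hsb x z⟩

include hK' hR' hu htb hts hsb in
theorem DifferentTwist.uniformization_eq_zero_iff {U : FractionalIdeal (𝓞 K)⁰ K}
    (hker : ∀ z, u z = 0 ↔ ∃ x ∈ U, Φ.embed x = z) (w : (Φ.lift K').carrier → ℂ) :
    e.uniformization u t b w = 0 ↔
      ∃ x ∈ FractionalIdeal.extendedHom K' (𝓞 K') U *
        FractionalIdeal.extendedHom K' (𝓞 K') (inverseDifferent F F'),
        (Φ.lift K').embed x = w := by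
  simp only [mem_extendedHom_mul_extendedHom_iff F hR']
  constructor
  · intro hw
    set z := fun i => Φ.deflate K' ((Φ.lift K').embed (algebraMap F' K' (b i)) * w) with hz
    have hwz : ∑ i, (Φ.lift K').embed (algebraMap F' K' (t i)) * Φ.inflate K' (z i) = w :=
      Φ.sum_embed_mul_inflate_deflate hK' htb w
    -- The `t i` may be dependent, so the `u (z i)` cannot be read off from `∑ t i ⊗ u (z i)`. But
    -- the vector `z` is fixed by the matrix `s j (t i)`, so contracting that sum with `s j`
    -- recovers `u (z j)`.
    have hz' (j) : z j = ∑ i, Φ.embed (algebraMap F K (algebraMap (𝓞 F) F (s j (t i)))) * z i := by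
      conv_lhs => rw [hz]
      dsimp only
      conv_lhs => rw [← hwz, Finset.mul_sum, map_sum]
      exact Finset.sum_congr rfl fun i _ => deflate_embed_mul_embed_mul_inflate hK' hsb _ _ _
    have hw' : ∑ i, t i ⊗ₜ[𝓞 F] u (z i) = 0 := by
      rw [← (e.equiv (specComplex k)).symm.map_eq_zero_iff, map_sum]
      exact hw
    have hu0 (j) : u (z j) = 0 := by
      have h := congrArg (TensorProduct.lid (𝓞 F) _ ∘ (s j).rTensor _) hw'
      simp only [Function.comp_apply, map_sum, LinearMap.rTensor_tmul, TensorProduct.lid_tmul,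
        map_zero] at h
      rw [hz', map_sum]
      simp only [map_embed_algebraMap_mul c hu]
      exact h
    choose y hyU hy using fun j => (hker (z j)).mp (hu0 j)
    refine ⟨∑ j, algebraMap F' K' (t j) * algebraMap K K' (y j),
      sum_mem fun j _ => AddSubgroup.subset_closure ⟨t j, (t j).2, y j, hyU j, rfl⟩, ?_⟩
    rw [map_sum, ← hwz]
    refine Finset.sum_congr rfl fun j _ => ?_
    rw [map_mul, CMType.embed_algebraMap, hy]
  · rintro ⟨x, hx, rfl⟩
    induction hx using AddSubgroup.closure_induction with
    | mem x hx =>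
      obtain ⟨x, hx, y, hy, rfl⟩ := hx
      rw [map_mul, CMType.embed_algebraMap]
      refine (e.uniformization_embed_mul_inflate c hK' hu hts hsb ⟨x, hx⟩ _).trans ?_
      rw [(hker _).mpr ⟨y, hy, rfl⟩, TensorProduct.tmul_zero, map_zero]
    | zero => rw [map_zero, map_zero]
    | add x y _ _ hx hy => rw [map_add, map_add, hx, hy, add_zero]
    | neg x _ hx => rw [map_neg, map_neg, hx, neg_zero]

include hK' hu htb hts hsb in
-- By additivity it suffices to take `w = t i * z` with `z` inflated, and `r = x * a` with `x ∈ 𝓞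
-- F'` and `a ∈ 𝓞 K`; then `x` acts on `t i`, and `a` on `z` by the equivariance of `u`.
theorem DifferentTwist.uniformization_embed_mul (r : 𝓞 K') (w : (Φ.lift K').carrier → ℂ) :
    e.uniformization u t b ((Φ.lift K').embed (algebraMap (𝓞 K') K' r) * w) =
      (e.cm hR' c).onPoints (specComplex k) r (e.uniformization u t b w) := by
  apply (e.equiv (specComplex k)).injective
  rw [e.equiv_cm_onPoints, ← Φ.sum_embed_mul_inflate_deflate hK' htb w, Finset.mul_sum]
  simp only [map_sum]
  refine Finset.sum_congr rfl fun i _ => ?_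
  generalize Φ.deflate K' ((Φ.lift K').embed (algebraMap F' K' (b i)) * w) = z
  obtain ⟨r, rfl⟩ := ringOfIntegersTensorHom_surjective (F := F) hR' r
  induction r using TensorProduct.induction_on with
  | zero => simp
  | add x y hx hy => simp only [map_add, add_mul, LinearMap.add_apply, hx, hy]
  | tmul x a =>
    rw [ringOfIntegersTensorHom_tmul, c.twistAction_mul, c.tensorAction_tmul,
      e.uniformization_embed_mul_inflate c hK' hu hts hsb, LinearEquiv.apply_symm_apply,
      LinearMap.lTensor_tmul, ← hu]
    have h : (Φ.lift K').embed (algebraMap (𝓞 K') K' (algebraMap (𝓞 F') (𝓞 K') x *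
        algebraMap (𝓞 K) (𝓞 K') a)) *
          ((Φ.lift K').embed (algebraMap F' K' (t i)) * Φ.inflate K' z) =
        (Φ.lift K').embed (algebraMap F' K' ((x • t i : InverseDifferent F F') : F')) *
          Φ.inflate K' (Φ.embed (algebraMap (𝓞 K) K a) * z) := by
      have h1 : algebraMap (𝓞 K') K' (algebraMap (𝓞 F') (𝓞 K') x) =
        algebraMap F' K' (algebraMap (𝓞 F') F' x) := rfl
      have h2 : algebraMap (𝓞 K') K' (algebraMap (𝓞 K) (𝓞 K') a) =
        algebraMap K K' (algebraMap (𝓞 K) K a) := rfl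
      rw [Submodule.coe_smul, Algebra.smul_def]
      simp only [map_mul, h1, h2, CMType.embed_algebraMap]
      ring
    rw [h, e.uniformization_embed_mul_inflate c hK' hu hts hsb, LinearEquiv.apply_symm_apply]
    rfl

omit [IsTotallyReal F'] [IsTotallyComplex K] [Algebra.IsQuadraticExtension F K] [Algebra F K]
  [Algebra F K'] [IsScalarTower F F' K'] [IsScalarTower F K K'] in
theorem DifferentTwist.isHolomorphicFamily_uniformization
    (hu : IsHolomorphicFamily fun z => (u z).hom.left) :
    IsHolomorphicFamily fun w => (e.uniformization (K' := K') u t b w).hom.left := by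
  refine IsHolomorphicFamily.sum Finset.univ fun i _ => ?_
  simp only [e.equiv_symm_tmul]
  let L : ((Φ.lift K').carrier → ℂ) →ₗ[ℂ] (Φ.carrier → ℂ) :=
    Φ.deflate K' ∘ₗ LinearMap.mulLeft ℂ ((Φ.lift K').embed (algebraMap F' K' (b i)))
  exact (hu.comp_differentiable
    (LinearMap.toContinuousLinearMap L).differentiable).comp_hom (e.tmulHom (t i)).left

end Uniformization

end HBAV

end

/-! ### The theorem -/

theorem mainTheorem7
    {k : Type} [Field k] [CharZero k] [Algebra k ℂ]
    {F F' K K' : Type*} [Field F] [NumberField F] [IsTotallyReal F]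
    [Field F'] [NumberField F'] [IsTotallyReal F'] [Algebra F F']
    [Field K] [NumberField K] [IsTotallyComplex K] [Algebra F K] [Algebra.IsQuadraticExtension F K]
    [Field K'] [NumberField K'] [Algebra F K'] [Algebra F' K'] [Algebra K K']
    [IsScalarTower F F' K'] [IsScalarTower F K K']
    (hK' : IntermediateField.adjoin K (Set.range (algebraMap F' K')) = ⊤)
    (hR' : (algebraMap (𝓞 K) (𝓞 K')).range ⊔ (algebraMap (𝓞 F') (𝓞 K')).range = ⊤)
    (Φ : CMType K) (U : FractionalIdeal (𝓞 K)⁰ K) (hU : U ≠ 0)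
    (A : HBAV k F) (c : A.CM K) (hA : c.CorrespondsTo Φ U)
    (A' : HBAV k F') (e : A.DifferentTwist A') :
    ∃ c' : A'.CM K',
      (∀ (T : Over (Spec (CommRingCat.of k))) (a : 𝓞 K) (x : A'.Points T),
        e.equiv T (c'.onPoints T (algebraMap (𝓞 K) (𝓞 K') a) x) =
          (c.onPoints T a).lTensor (InverseDifferent F F') (e.equiv T x)) ∧
      c'.CorrespondsTo (Φ.lift K')
        (FractionalIdeal.extendedHom K' (𝓞 K') U *
          (((differentIdeal (𝓞 F) (𝓞 F')).map (algebraMap (𝓞 F') (𝓞 K')) : Ideal (𝓞 K')) :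
            FractionalIdeal (𝓞 K')⁰ K')⁻¹) := by
  obtain ⟨u, hsurj, hker, hu, hopen, hdiff⟩ := hA
  obtain ⟨n, t, s, b, htb, hts, hsb⟩ :=
    FractionalIdeal.exists_dual_basis (F := F) (inverseDifferent_ne_zero (F := F) (F' := F'))
  have hhol := e.isHolomorphicFamily_uniformization (K' := K') (t := t) (b := b) ⟨hopen, hdiff⟩
  refine ⟨e.cm hR' c, e.equiv_cm_onPoints_algebraMap hR' c, e.uniformization u t b,
    e.uniformization_surjective (Φ := Φ) (s := s) (t := t) (b := b) c hK' hu hts hsb hsurj, ?_,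
    e.uniformization_embed_mul c hK' hR' hu htb hts hsb, hhol.isOpen, hhol.differentiableOn⟩
  rw [← extendedHom_inverseDifferent]
  exact e.uniformization_eq_zero_iff c hK' hR' hu htb hts hsb hker
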